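/- Let $M$ be a smooth manifold with a normal almost contact metric structure $(g,\xi,\eta,\varphi)$: $g$ is a Riemannian metric, $\xi$ a unit vector field, $\eta=g(\xi,\cdot)$, and $\varphi$ an endomorphism of $TM$ with $\varphi(\xi)=0$, $\varphi^2=-1+\eta\otimes\xi$, $g(\varphi X,\varphi Y)=g(X,Y)-\eta(X)\eta(Y)$, such that $$[\varphi X,\varphi Y]+\varphi^2[X,Y]-\varphi[\varphi X,Y]-\varphi[X,\varphi Y]+d\eta(X,Y)\,\xi=0$$ for all vector fields $X,Y$, where $d\eta(X,Y)=X(\eta(Y))-Y(\eta(X))-\eta([X,Y])$. Let $\sigma_1,\sigma_2$ be closed, $\varphi$-invariant $2$-forms on $M$ (that is, $\sigma_i(\varphi\cdot,\varphi\cdot)=\sigma_i$), and let $\pi:\hat M\to M$ be a principal $S^1\times S^1$-bundle whose Chern classes are represented by $\sigma_1,\sigma_2$ (in particular, $\sigma_1,\sigma_2$ are integral); that is, for some connection form $(\omega_1',\omega_2')$ one has $\frac1{2\pi}d\omega_i'=\pi^*\tau_i$ with $\tau_i$ cohomologous to $\sigma_i$. Then there are connection forms $\omega=(\omega_1,\omega_2)$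 on $\hat M$ with $\frac1{2\pi}d\omega_i=\pi^*\sigma_i$. For every such $\omega$ and all real constants $s,t$ with $s^2+t^2=1$, an ST structure on $\hat M$, i.e. a normal almost contact metric structure $(\hat g,\hat\xi,\hat\eta,\hat\varphi)$ whose Reeb field $\hat\xi$ is Killing, is given by $$\hat g(X,Y)=\omega_1(X)\omega_1(Y)+\omega_2(X)\omega_2(Y)+g(\pi_*X,\pi_*Y),$$ $$\hat\xi=tX_1+sX_2,\qquad \hat\eta=t\omega_1+s\omega_2,\qquad \hat\varphi=\varphi+\hat\eta^\perp\otimes\xi-\eta\otimes\hat\xi^\perp,$$ where $X_1,X_2$ are the fundamental vector fields of the two circle factors (of period $2\pi$), so that $\omega_i(X_j)=\delta_{ij}$, where $\hat\xi^\perp=-sX_1+tX_2$ and $\hat\eta^\perp=-s\omega_1+t\omega_2$, and where tensors on $M$ are lifted to $\hat M$ horizontally, i.e. to $\ker\omega_1\cap\ker\omega_2$; explicitly $\hat\varphi(v)=(\varphi(\pi_*v))^{h}+\hat\eta^\perp(v)\,\xi^{h}-\eta(\pi_*v)\,\hat\xi^\perp$, with $u^h$ the horizontal lift of $u$. -/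

import Mathlib

open scoped Manifold ContDiff

noncomputable section

namespace TorusBundleST

/-! ## Tensor fields on a real manifold -/

section Tensors

variable {E : Type*} [NormedAddCommGroup E] [NormedSpace ℝ E]
  {H : Type*} [TopologicalSpace H] (I : ModelWithCorners ℝ E H)
  (M : Type*) [TopologicalSpace M] [ChartedSpace H M]

/-- Vector fields (not necessarily smooth). -/
abbrev VField : Type _ := ∀ x : M, TangentSpace I x

/-- Fields of linear forms (not necessarily smooth). -/
abbrev OneTensor : Type _ := ∀ x : M, TangentSpace I x →L[ℝ] ℝ

/-- Fields of bilinear forms (not necessarily smooth). -/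
abbrev TwoTensor : Type _ := ∀ x : M, TangentSpace I x →L[ℝ] TangentSpace I x →L[ℝ] ℝ

/-- Fields of endomorphisms of the tangent bundle (not necessarily smooth). -/
abbrev EndTensor : Type _ := ∀ x : M, TangentSpace I x →L[ℝ] TangentSpace I x

variable {I M}

variable [IsManifold I ∞ M]

/-- `X` is a smooth vector field. -/
def SmoothField (X : VField I M) : Prop :=
  ContMDiff I I.tangent ∞ (fun x => (⟨x, X x⟩ : TangentBundle I M))

/-- `α` is a smooth `1`-form: a smooth section of the bundle `Hom(TM, ℝ)`. -/
def SmoothOneForm (α : OneTensor I M) : Prop :=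
  ContMDiff I (I.prod 𝓘(ℝ, E →L[ℝ] ℝ)) ∞
    (fun x => Bundle.TotalSpace.mk' (E →L[ℝ] ℝ)
      (E := fun x : M => TangentSpace I x →L[ℝ] Bundle.Trivial M ℝ x) x (α x))

/-- `σ` is a smooth `2`-form: alternating, and a smooth section of `Hom(TM, Hom(TM, ℝ))`. -/
structure SmoothTwoForm (σ : TwoTensor I M) : Prop where
  alternating : ∀ (x : M) (v : TangentSpace I x), σ x v v = 0
  smooth : ContMDiff I (I.prod 𝓘(ℝ, E →L[ℝ] E →L[ℝ] ℝ)) ∞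
    (fun x => Bundle.TotalSpace.mk' (E →L[ℝ] E →L[ℝ] ℝ)
      (E := fun x : M => TangentSpace I x →L[ℝ] TangentSpace I x →L[ℝ] Bundle.Trivial M ℝ x)
      x (σ x))

/-- `φ` is a smooth endomorphism of `TM`: a smooth section of `Hom(TM, TM)`. -/
def SmoothEnd (φ : EndTensor I M) : Prop :=
  ContMDiff I (I.prod 𝓘(ℝ, E →L[ℝ] E)) ∞
    (fun x => Bundle.TotalSpace.mk' (E →L[ℝ] E)
      (E := fun x : M => TangentSpace I x →L[ℝ] TangentSpace I x) x (φ x))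

/-- The derivative `X f` of the real function `f` along the vector field `X`. -/
def dirDeriv (X : VField I M) (f : M → ℝ) (x : M) : ℝ :=
  mfderiv I 𝓘(ℝ, ℝ) f x (X x)

/-- The exterior derivative of a `1`-form, evaluated on two vector fields:
`dα(X, Y) = X(α(Y)) - Y(α(X)) - α([X, Y])`. -/
def dOne (α : OneTensor I M) (X Y : VField I M) (x : M) : ℝ :=
  dirDeriv X (fun y => α y (Y y)) x - dirDeriv Y (fun y => α y (X y)) x
    - α x (VectorField.mlieBracket I X Y x)

/-- The exterior derivative of a `2`-form, evaluated on three vector fields. -/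
def dTwo (σ : TwoTensor I M) (X Y Z : VField I M) (x : M) : ℝ :=
  dirDeriv X (fun y => σ y (Y y) (Z y)) x
    + dirDeriv Y (fun y => σ y (Z y) (X y)) x
    + dirDeriv Z (fun y => σ y (X y) (Y y)) x
    - σ x (VectorField.mlieBracket I X Y x) (Z x)
    - σ x (VectorField.mlieBracket I Y Z x) (X x)
    - σ x (VectorField.mlieBracket I Z X x) (Y x)

/-- `dσ = 0`. -/
def ClosedTwoForm (σ : TwoTensor I M) : Prop :=
  ∀ X Y Z : VField I M, SmoothField X → SmoothField Y → SmoothField Z →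
    ∀ x : M, dTwo σ X Y Z x = 0

/-- The `2`-forms `σ` and `τ` differ by `dα` for a smooth `1`-form `α`, that is, closed forms
`σ`, `τ` have the same de Rham class. -/
def Cohomologous (σ τ : TwoTensor I M) : Prop :=
  ∃ α : OneTensor I M, SmoothOneForm α ∧
    ∀ X Y : VField I M, SmoothField X → SmoothField Y →
      ∀ x : M, σ x (X x) (Y x) - τ x (X x) (Y x) = dOne α X Y x

end Tensors

/-! ## Almost contact metric structures and ST structures -/

section Contact

variable {E : Type*} [NormedAddCommGroup E] [NormedSpace ℝ E]
  {H : Type*} [TopologicalSpace H] (I : ModelWithCorners ℝ E H)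
  (M : Type*) [TopologicalSpace M] [ChartedSpace H M] [IsManifold I ∞ M]

/-- An almost contact metric structure `(g, ξ, η, φ)`. The `1`-form `η` is the metric dual of `ξ`
and is therefore not a separate field, see `AlmostContactMetric.η`. -/
structure AlmostContactMetric where
  /-- The smooth Riemannian metric. -/
  g : Bundle.ContMDiffRiemannianMetric I ∞ E (fun x : M => TangentSpace I x)
  /-- The Reeb vector field. -/
  ξ : VField I M
  /-- The endomorphism of the tangent bundle. -/
  φ : EndTensor I M
  smooth_ξ : SmoothField ξ
  smooth_φ : SmoothEnd φ
  unit_ξ : ∀ x, g.inner x (ξ x) (ξ x) = 1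
  φ_ξ : ∀ x, φ x (ξ x) = 0
  φ_φ : ∀ (x : M) (v : TangentSpace I x), φ x (φ x v) = -v + g.inner x (ξ x) v • ξ x
  g_φ_φ : ∀ (x : M) (v w : TangentSpace I x),
    g.inner x (φ x v) (φ x w) = g.inner x v w - g.inner x (ξ x) v * g.inner x (ξ x) w

variable {I M}

namespace AlmostContactMetric

variable (S : AlmostContactMetric I M)

/-- The dual `1`-form `η = g(ξ, ·)`. -/
def η : OneTensor I M := fun x => S.g.inner x (S.ξ x)

/-- The vector field `φ(X)`. -/
def applyφ (X : VField I M) : VField I M := fun x => S.φ x (X x)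

/-- The Sasaki-Hatakeyama tensor
`S(X, Y) = [φX, φY] + φ²[X, Y] - φ[φX, Y] - φ[X, φY] + dη(X, Y) ξ`. -/
def sasakiHatakeyama (X Y : VField I M) : VField I M := fun x =>
  VectorField.mlieBracket I (S.applyφ X) (S.applyφ Y) x
    + S.φ x (S.φ x (VectorField.mlieBracket I X Y x))
    - S.φ x (VectorField.mlieBracket I (S.applyφ X) Y x)
    - S.φ x (VectorField.mlieBracket I X (S.applyφ Y) x)
    + dOne S.η X Y x • S.ξ x

/-- The structure is normal if its Sasaki-Hatakeyama tensor vanishes. -/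
def IsNormal : Prop :=
  ∀ X Y : VField I M, SmoothField X → SmoothField Y → ∀ x : M, S.sasakiHatakeyama X Y x = 0

/-- `ξ` is a Killing field: `(L_ξ g)(X, Y) = ξ(g(X, Y)) - g([ξ, X], Y) - g(X, [ξ, Y]) = 0`. -/
def IsKilling : Prop :=
  ∀ X Y : VField I M, SmoothField X → SmoothField Y → ∀ x : M,
    dirDeriv S.ξ (fun y => S.g.inner y (X y) (Y y)) x
      - S.g.inner x (VectorField.mlieBracket I S.ξ X x) (Y x)
      - S.g.inner x (X x) (VectorField.mlieBracket I S.ξ Y x) = 0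

/-- A Sasaki with torsion (ST) structure: a normal almost contact metric structure whose Reeb
vector field is Killing. -/
structure IsST : Prop where
  normal : S.IsNormal
  killing : S.IsKilling

/-- The bilinear form `σ` is `φ`-invariant: `σ(φ·, φ·) = σ`. -/
def Invariant (σ : TwoTensor I M) : Prop :=
  ∀ (x : M) (v w : TangentSpace I x), σ x (S.φ x v) (S.φ x w) = σ x v w

end AlmostContactMetric

end Contact

/-! ## Principal torus bundles -/

/-- The torus `S¹ × S¹` as a Lie group. -/
abbrev Torus : Type := Circle × Circle

/-- The model of the torus as a manifold. -/
abbrev torusModel := (𝓡 1).prod (𝓡 1)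

section Bundle

variable {E : Type*} [NormedAddCommGroup E] [NormedSpace ℝ E]
  {H : Type*} [TopologicalSpace H] (I : ModelWithCorners ℝ E H)
  {M : Type*} [TopologicalSpace M] [ChartedSpace H M]
  {E' : Type*} [NormedAddCommGroup E'] [NormedSpace ℝ E']
  {H' : Type*} [TopologicalSpace H'] (I' : ModelWithCorners ℝ E' H')
  {P : Type*} [TopologicalSpace P] [ChartedSpace H' P] [MulAction Torus P]

/-- `π : P → M` is a smooth principal torus bundle: the torus acts smoothly on `P` along the fibres
of `π`, and over an open neighbourhood of each point of `M` there is a smooth equivariant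
trivialization. (The torus is commutative, so left and right actions are the same.) -/
structure IsPrincipalTorusBundle (π : P → M) : Prop where
  smooth_proj : ContMDiff I' I ∞ π
  smooth_act : ContMDiff (torusModel.prod I') I' ∞ (fun q : Torus × P => q.1 • q.2)
  proj_act : ∀ (a : Torus) (p : P), π (a • p) = π p
  locally_trivial : ∀ x : M, ∃ e : Bundle.Trivialization Torus π, x ∈ e.baseSet ∧
    ContMDiffOn I' (I.prod torusModel) ∞ e e.source ∧
    ContMDiffOn (I.prod torusModel) I' ∞ e.toOpenPartialHomeomorph.symm e.target ∧
    ∀ (a : Torus), ∀ p ∈ e.source, (e (a • p)).2 = a * (e p).2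

/-- The fundamental vector field of the element `(a, b)` of the Lie algebra `ℝ²` of the torus: its
value at `p` is the velocity at time `0` of the curve `t ↦ (exp(iat), exp(ibt)) • p`. -/
def fundamentalField (a b : ℝ) : VField I' P := fun p =>
  (mfderiv 𝓘(ℝ, ℝ) I' (fun t : ℝ => ((Circle.exp (a * t), Circle.exp (b * t)) : Torus) • p) 0
    (1 : ℝ) : E')

/-- The fundamental vector field `X₁` of the first circle factor (of period `2π`). -/
def fundX₁ : VField I' P := fundamentalField I' 1 0

/-- The fundamental vector field `X₂` of the second circle factor (of period `2π`). -/
def fundX₂ : VField I' P := fundamentalField I' 0 1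

variable {I'}

/-- `ω = (ω₁, ω₂)` is a connection form: smooth, reproducing the generators of the fundamental
vector fields, and invariant under the torus. -/
structure IsConnection [IsManifold I' ∞ P] (ω₁ ω₂ : OneTensor I' P) : Prop where
  smooth₁ : SmoothOneForm ω₁
  smooth₂ : SmoothOneForm ω₂
  fund₁₁ : ∀ p, ω₁ p (fundX₁ I' p) = 1
  fund₁₂ : ∀ p, ω₁ p (fundX₂ I' p) = 0
  fund₂₁ : ∀ p, ω₂ p (fundX₁ I' p) = 0
  fund₂₂ : ∀ p, ω₂ p (fundX₂ I' p) = 1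
  invariant₁ : ∀ (a : Torus) (p : P) (v : TangentSpace I' p),
    ω₁ (a • p) (mfderiv I' I' (fun q : P => a • q) p v) = ω₁ p v
  invariant₂ : ∀ (a : Torus) (p : P) (v : TangentSpace I' p),
    ω₂ (a • p) (mfderiv I' I' (fun q : P => a • q) p v) = ω₂ p v

variable {I}

/-- The `1`-form `η` on the total space satisfies `(1 / 2π) dη = π^* σ`. -/
def HasCurvature [IsManifold I' ∞ P] (π : P → M) (η : OneTensor I' P) (σ : TwoTensor I M) : Prop :=
  ∀ X Y : VField I' P, SmoothField X → SmoothField Y → ∀ p : P,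
    1 / (2 * Real.pi) * dOne η X Y p
      = σ (π p) (mfderiv I' I π p (X p)) (mfderiv I' I π p (Y p))

/-- The closed forms `σ₁`, `σ₂` represent the Chern classes of the principal torus bundle `π`
(Chern-Weil): they are cohomologous to the normalized curvature forms of some connection. -/
def HasChernClasses [IsManifold I ∞ M] [IsManifold I' ∞ P] (π : P → M)
    (σ₁ σ₂ : TwoTensor I M) : Prop :=
  ∃ (ω₁ ω₂ : OneTensor I' P) (τ₁ τ₂ : TwoTensor I M),
    IsConnection ω₁ ω₂ ∧ SmoothTwoForm τ₁ ∧ SmoothTwoForm τ₂ ∧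
    HasCurvature π ω₁ τ₁ ∧ HasCurvature π ω₂ τ₂ ∧
    Cohomologous σ₁ τ₁ ∧ Cohomologous σ₂ τ₂

open Classical in
/-- The horizontal lift to `p` of a tangent vector `u` at `π p`: the vector `w` at `p` which
projects to `u` and satisfies `ω₁(w) = ω₂(w) = 0`. (It exists and is unique for a connection form
on a principal torus bundle; the value `0` is never used.) -/
def horizontalLift (π : P → M) (ω₁ ω₂ : OneTensor I' P) (p : P) (u : TangentSpace I (π p)) :
    TangentSpace I' p :=
  if h : ∃ w : TangentSpace I' p, mfderiv I' I π p w = u ∧ ω₁ p w = 0 ∧ ω₂ p w = 0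
  then h.choose else 0

end Bundle

end TorusBundleST

end

set_option linter.unusedSectionVars false

namespace TorusBundleST

/-! ## Calculus of vector-valued functions along vector fields -/

section Calculus

variable {E : Type*} [NormedAddCommGroup E] [NormedSpace ℝ E]
  {H : Type*} [TopologicalSpace H] {I : ModelWithCorners ℝ E H}
  {M : Type*} [TopologicalSpace M] [ChartedSpace H M]
  {F : Type*} [NormedAddCommGroup F] [NormedSpace ℝ F]
  {G : Type*} [NormedAddCommGroup G] [NormedSpace ℝ G]

/-! Existence of `ω` is a change of connection: if `σᵢ - τᵢ = dαᵢ`, then `ωᵢ' + 2π π^*αᵢ` is again a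
connection form, because a pull-back is torus-invariant and kills vertical vectors, and its
normalized curvature is `π^*σᵢ` (`HasChernClasses.exists_connection`).

For the ST structure put `α = η̂`, `β = η̂^⊥`, `ζ = ξ̂`, `χ = ξ̂^⊥`. Since `s² + t² = 1`, this is a
rotation of `(ω₁, ω₂)` and `(X₁, X₂)`, so `ĝ = α² + β² + π^*g`. The map `(π_*, α, β)` identifies
each tangent space of `P` with `TM ⊕ ℝ ⊕ ℝ`, where `φ̂` becomes `(u, a, b) ↦ (φ u + b ξ, 0, -η u)`;
the algebraic identities follow from those on `M`. All that is used about the curvature is that `dα`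
and `dβ` are pull-backs of forms `κ₁`, `κ₂` on `M`, constant combinations of the `σᵢ` and hence
`φ`-invariant; in particular `ξ` contracts them to zero.

Normality (`isNormal_totalStructure`) is checked on the three components of the Sasaki-Hatakeyama
tensor. Under `α` the term `-κ₁(φ·, φ·)` from `[φ̂X, φ̂Y]` cancels `dη̂(X, Y)`. Under `β` the `κ₂`
terms cancel by invariance, and what remains is `dη(φ·, ·) + dη(·, φ·) = 0` on `M`. Under `π_*`
there remain normality on `M`, `L_ξ φ = 0`, and `κ₂(φ·, ·) + κ₂(·, φ·) = 0`. The facts on `M` are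
consequences of normality there (`NormalJet`).

The field `ζ` is Killing because it is vertical with constant `α(ζ)`, `β(ζ)`: then `L_ζ α = L_ζ β =
0`, and the pull-back of `g` does not change along `ζ`.

A vector field `X` on `P` need not project to `M`, so `π_* X` is treated as a vector-valued function
on `P`, read in a chart at `π p` (`pushCoord`). The identity `[X, Y] f = X(Y f) - Y(X f)` for
vector-valued `f`, applied to the chart composed with `π`, gives `π_*[X, Y]`
(`pushCoord_mlieBracket`), and everything reduces to the Leibniz rule and linear algebra at one
point. -/

lemma dirDeriv_eq_mvfderiv (X : VField I M) (f : M → ℝ) (x : M) :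
    dirDeriv X f x = mvfderiv I f x (X x) := rfl

lemma mvfderiv_congr {f g : M → F} {x : M} (h : f =ᶠ[nhds x] g) :
    mvfderiv I f x = mvfderiv I g x := by
  ext v
  have := h.mfderiv_eq (I := I) (I' := 𝓘(ℝ, F))
  exact congrArg (fun L : E →L[ℝ] F => L v) this

/-- The Leibniz rule in the form needed for tensors: in a chart a tensor field is operator-valued,
and applying it to a field is evaluation. -/
lemma mvfderiv_clm_apply {A : M → F →L[ℝ] G} {v : M → F} {x : M}
    (hA : MDifferentiableAt I 𝓘(ℝ, F →L[ℝ] G) A x) (hv : MDifferentiableAt I 𝓘(ℝ, F) v x)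
    (w : TangentSpace I x) :
    mvfderiv I (fun y => A y (v y)) x w
      = mvfderiv I A x w (v x) + A x (mvfderiv I v x w) := by
  have hA' := hA.hasMFDerivAt
  have hv' := hv.hasMFDerivAt
  have key := (HasFDerivWithinAt.clm_apply hA'.2 hv'.2)
  have : HasMFDerivAt I 𝓘(ℝ, G) (fun y => A y (v y)) x
      ((ContinuousLinearMap.apply ℝ G (v x)).comp (mvfderiv I A x)
        + (A x).comp (mvfderiv I v x) : TangentSpace I x →L[ℝ] G) := by
    refine ⟨hA'.1.clm_apply hv'.1, ?_⟩
    convert! key using 1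
    simp [writtenInExtChartAt, mvfderiv, add_comm]
    rfl
  have h2 : mvfderiv I (fun y => A y (v y)) x =
      (ContinuousLinearMap.apply ℝ G (v x)).comp (mvfderiv I A x)
        + (A x).comp (mvfderiv I v x) := this.mfderiv
  rw [h2]; rfl

lemma mvfderiv_clm_apply_const (L : F →L[ℝ] G) {v : M → F} {x : M}
    (hv : MDifferentiableAt I 𝓘(ℝ, F) v x) (w : TangentSpace I x) :
    mvfderiv I (fun y => L (v y)) x w = L (mvfderiv I v x w) := by
  have := mvfderiv_clm_apply (I := I) (A := fun _ => L) mdifferentiableAt_const hv w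
  simpa [mvfderiv_const] using this

variable [IsManifold I ∞ M]

/-- The derivative of a smooth function along a smooth vector field is smooth. -/
lemma contMDiffAt_mvfderiv_apply {f : M → F} {x : M} (hf : ContMDiffAt I 𝓘(ℝ, F) ∞ f x)
    {X : VField I M} (hX : SmoothField X) :
    ContMDiffAt I 𝓘(ℝ, F) ∞ (fun y => mvfderiv I f y (X y)) x := by
  have h1 := ContMDiffAt.mfderiv_const (m := ∞) hf (by simp)
  have h2 := ContMDiffAt.clm_apply_of_inCoordinates (b₁ := id) (b₂ := f) h1 (hX x) hf
  exact (contMDiff_snd_tangentBundle_modelSpace F 𝓘(ℝ, F)).contMDiffAt.comp x h2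

lemma eventually_mdifferentiableAt {f : M → F} {x : M} (hf : ContMDiffAt I 𝓘(ℝ, F) ∞ f x) :
    ∀ᶠ y in nhds x, MDifferentiableAt I 𝓘(ℝ, F) f y := by
  have h1 : ContMDiffAt I 𝓘(ℝ, F) 1 f x := hf.of_le (by norm_cast)
  filter_upwards [(contMDiffAt_iff_contMDiffAt_nhds (by simp)).1 h1] with y hy
  exact hy.mdifferentiableAt one_ne_zero

/-- Chain rule: the derivative of the inverse chart cancels the inverse used to pull `X` back. -/
lemma fderiv_comp_extChartAt_symm [I.Boundaryless] {f : M → F} {x : M} {z : E}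
    (hz : z ∈ (extChartAt I x).target)
    (hf : MDifferentiableAt I 𝓘(ℝ, F) f ((extChartAt I x).symm z)) (X : VField I M) :
    fderiv ℝ (f ∘ (extChartAt I x).symm) z
        (VectorField.mpullbackWithin 𝓘(ℝ, E) I (extChartAt I x).symm X (Set.range I) z)
      = mvfderiv I f ((extChartAt I x).symm z) (X ((extChartAt I x).symm z)) := by
  have h1 := isInvertible_mfderivWithin_extChartAt_symm (I := I) hz
  have hs : MDifferentiableAt 𝓘(ℝ, E) I (extChartAt I x).symm z := by
    have := mdifferentiableWithinAt_extChartAt_symm (I := I) hz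
    rwa [I.range_eq_univ, mdifferentiableWithinAt_univ] at this
  have h2 := mfderiv_comp z hf hs
  rw [VectorField.mpullbackWithin_apply]
  have h3 := h1.self_apply_inverse (X ((extChartAt I x).symm z))
  rw [I.range_eq_univ, mfderivWithin_univ] at h3 ⊢
  rw [mfderiv_eq_fderiv] at h2
  rw [h2]
  exact congrArg (mfderiv I 𝓘(ℝ, F) f ((extChartAt I x).symm z)) h3

/-- The bracket acts on vector-valued functions as the commutator of derivations. -/
lemma mvfderiv_mlieBracket [I.Boundaryless] [CompleteSpace E]
    {f : M → F} {x : M} (hf : ContMDiffAt I 𝓘(ℝ, F) ∞ f x) {X Y : VField I M}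
    (hX : SmoothField X) (hY : SmoothField Y) :
    mvfderiv I f x (VectorField.mlieBracket I X Y x)
      = mvfderiv I (fun y => mvfderiv I f y (Y y)) x (X x)
        - mvfderiv I (fun y => mvfderiv I f y (X y)) x (Y x) := by
  have hI2 : IsManifold I 2 M := IsManifold.of_le (n := ∞) (by norm_cast)
  set z := extChartAt I x x with hz
  have hzt : z ∈ (extChartAt I x).target := mem_extChartAt_target x
  have hzx : (extChartAt I x).symm z = x := extChartAt_to_inv x
  let pull : VField I M → E → E := fun W =>
    VectorField.mpullbackWithin 𝓘(ℝ, E) I (extChartAt I x).symm W (Set.range I)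
  have hset : (extChartAt I x).symm ⁻¹' Set.univ ∩ Set.range I = Set.univ := by
    rw [I.range_eq_univ, Set.preimage_univ, Set.inter_univ]
  have hdiff : ∀ W : VField I M, SmoothField W → DifferentiableAt ℝ (pull W) z := by
    intro W hW
    have h1 : MDifferentiableWithinAt I I.tangent (fun y => (⟨y, W y⟩ : TangentBundle I M))
        Set.univ x := ((hW x).mdifferentiableAt (by simp)).mdifferentiableWithinAt
    have := h1.differentiableWithinAt_mpullbackWithin_vectorField
    rw [hset] at this
    exact differentiableWithinAt_univ.1 this
  have hcont : ContDiffAt ℝ ∞ (f ∘ (extChartAt I x).symm) z := by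
    have := (contMDiffAt_iff.1 hf).2
    rw [I.range_eq_univ] at this
    exact this.contDiffAt Filter.univ_mem
  have hbr : mvfderiv I f x (VectorField.mlieBracket I X Y x)
      = fderiv ℝ (f ∘ (extChartAt I x).symm) z (VectorField.lieBracket ℝ (pull X) (pull Y) z) := by
    -- At its own base point the preferred chart has the identity as derivative, so the bracket at
    -- `x` is the bracket of the pulled-back fields at `z`.
    rw [(hf.mdifferentiableAt (by simp)).mvfderiv, ← VectorField.mlieBracketWithin_univ,
      VectorField.mlieBracketWithin_apply, mfderiv_extChartAt_self]
    rw [hset]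
    change fderivWithin ℝ (f ∘ (extChartAt I x).symm) (Set.range I) z
      ((ContinuousLinearMap.id ℝ E).inverse
        (VectorField.lieBracketWithin ℝ (pull X) (pull Y) Set.univ z)) = _
    rw [ContinuousLinearMap.inverse_id, VectorField.lieBracketWithin_univ, I.range_eq_univ,
      fderivWithin_univ]
    rfl
  have hbase : ∀ (h : M → F) (W : VField I M), MDifferentiableAt I 𝓘(ℝ, F) h x →
      fderiv ℝ (h ∘ (extChartAt I x).symm) z (pull W z) = mvfderiv I h x (W x) := by
    intro h W hh
    rw [fderiv_comp_extChartAt_symm hzt (by rwa [hzx]) W]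
    exact congrArg (fun y => mvfderiv I h y (W y)) hzx
  -- Needed on a neighbourhood and not only at `z`, because these functions are differentiated once
  -- more.
  have hnear : ∀ W : VField I M,
      (fun y => fderiv ℝ (f ∘ (extChartAt I x).symm) y (pull W y))
        =ᶠ[nhds z] (fun y => mvfderiv I f y (W y)) ∘ (extChartAt I x).symm := by
    intro W
    have hc : Filter.Tendsto (extChartAt I x).symm (nhds z) (nhds x) := by
      have := continuousAt_extChartAt_symm (I := I) x
      rwa [ContinuousAt, extChartAt_to_inv] at this
    filter_upwards [hc.eventually (eventually_mdifferentiableAt hf),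
      extChartAt_target_mem_nhds (I := I) x] with y hy hyt
    exact fderiv_comp_extChartAt_symm hyt hy W
  rw [hbr, VectorField.fderiv_apply_lieBracket hcont (by simp; norm_cast)
    (hdiff Y hY) (hdiff X hX), (hnear X).fderiv_eq, (hnear Y).fderiv_eq,
    hbase _ X ((contMDiffAt_mvfderiv_apply hf hY).mdifferentiableAt (by simp)),
    hbase _ Y ((contMDiffAt_mvfderiv_apply hf hX).mdifferentiableAt (by simp))]

end Calculus
end TorusBundleST

namespace TorusBundleST

/-! ## Tensor fields in coordinates -/

section Coordinates

variable {E : Type*} [NormedAddCommGroup E] [NormedSpace ℝ E]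
  {H : Type*} [TopologicalSpace H] (I : ModelWithCorners ℝ E H)
  {M : Type*} [TopologicalSpace M] [ChartedSpace H M] [IsManifold I ∞ M]

/-- The coordinates of tangent vectors at `y` in the preferred chart at `x₀`. -/
noncomputable def coord (x₀ y : M) : TangentSpace I y →L[ℝ] E :=
  (trivializationAt E (TangentSpace I) x₀).continuousLinearMapAt ℝ y

/-- The tangent vector at `y` with given coordinates in the preferred chart at `x₀`. -/
noncomputable def coordSymm (x₀ y : M) : E →L[ℝ] TangentSpace I y :=
  (trivializationAt E (TangentSpace I) x₀).symmL ℝ y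

variable {I}

lemma coord_coordSymm {x₀ y : M} (hy : y ∈ (chartAt H x₀).source) (v : E) :
    coord I x₀ y (coordSymm I x₀ y v) = v :=
  (trivializationAt E (TangentSpace I) x₀).continuousLinearMapAt_symmL hy v

lemma coordSymm_coord {x₀ y : M} (hy : y ∈ (chartAt H x₀).source) (v : TangentSpace I y) :
    coordSymm I x₀ y (coord I x₀ y v) = v :=
  (trivializationAt E (TangentSpace I) x₀).symmL_continuousLinearMapAt hy v

lemma coord_eq_mvfderiv {x₀ y : M} (hy : y ∈ (chartAt H x₀).source) :
    coord I x₀ y = mvfderiv I (extChartAt I x₀) y :=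
  TangentBundle.continuousLinearMapAt_trivializationAt hy

lemma smoothField_iff_coord {X : VField I M} :
    SmoothField X ↔
      ∀ x₀, ContMDiffAt I 𝓘(ℝ, E) ∞ (fun y => coord I x₀ y (X y)) x₀ := by
  refine forall_congr' fun x₀ => ?_
  rw [Bundle.contMDiffAt_totalSpace]
  refine (and_iff_right contMDiffAt_id).trans (Filter.EventuallyEq.contMDiffAt_iff ?_)
  filter_upwards [(chartAt H x₀).open_source.mem_nhds (mem_chart_source H x₀)] with y hy
  exact ((trivializationAt E (TangentSpace I) x₀).continuousLinearMapAt_apply_of_mem ℝ hy _).symm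

lemma smoothOneForm_iff_coord {α : OneTensor I M} :
    SmoothOneForm α ↔
      ∀ x₀, ContMDiffAt I 𝓘(ℝ, E →L[ℝ] ℝ) ∞ (fun y => (α y).comp (coordSymm I x₀ y)) x₀ := by
  refine forall_congr' fun x₀ => ?_
  rw [contMDiffAt_hom_bundle]
  refine (and_iff_right contMDiffAt_id).trans (Filter.EventuallyEq.contMDiffAt_iff ?_)
  refine Filter.Eventually.of_forall fun y => ?_
  ext v
  simp [ContinuousLinearMap.inCoordinates, coordSymm]

lemma smoothEnd_iff_coord {φ : EndTensor I M} :
    SmoothEnd φ ↔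
      ∀ x₀, ContMDiffAt I 𝓘(ℝ, E →L[ℝ] E) ∞
        (fun y => (coord I x₀ y).comp ((φ y).comp (coordSymm I x₀ y))) x₀ := by
  refine forall_congr' fun x₀ => ?_
  rw [contMDiffAt_hom_bundle]
  exact and_iff_right contMDiffAt_id

lemma smoothTwoTensor_iff_coord {σ : TwoTensor I M} :
    ContMDiff I (I.prod 𝓘(ℝ, E →L[ℝ] E →L[ℝ] ℝ)) ∞
      (fun x => Bundle.TotalSpace.mk' (E →L[ℝ] E →L[ℝ] ℝ)
        (E := fun x : M => TangentSpace I x →L[ℝ] TangentSpace I x →L[ℝ] Bundle.Trivial M ℝ x)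
        x (σ x)) ↔
      ∀ x₀, ContMDiffAt I 𝓘(ℝ, E →L[ℝ] E →L[ℝ] ℝ) ∞
        (fun y => ((coordSymm I x₀ y).precomp ℝ).comp ((σ y).comp (coordSymm I x₀ y))) x₀ := by
  refine forall_congr' fun x₀ => ?_
  rw [contMDiffAt_hom_bundle]
  refine (and_iff_right contMDiffAt_id).trans (Filter.EventuallyEq.contMDiffAt_iff ?_)
  filter_upwards [(chartAt H x₀).open_source.mem_nhds (mem_chart_source H x₀)] with y hy
  ext v w
  have := inCoordinates_apply_eq₂ (F₁ := E) (E₁ := (TangentSpace I : M → Type _)) (F₂ := E)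
    (E₂ := (TangentSpace I : M → Type _)) (F₃ := ℝ) (E₃ := Bundle.Trivial M ℝ) (x₀ := x₀) (x := y)
    (ϕ := σ y) (v := v) (w := w) hy hy (Set.mem_univ _)
  have hsymm : ∀ u : E, (trivializationAt E (TangentSpace I) x₀).symm y u = coordSymm I x₀ y u :=
    fun u => ((trivializationAt E (TangentSpace I) x₀).symmL_apply (R := ℝ) hy u).symm
  rw [hsymm, hsymm] at this
  refine this.trans ?_
  simp

end Coordinates
end TorusBundleST

namespace TorusBundleST

/-! ### Smooth sections and local extension of vectors -/

section Sections

variable {E : Type*} [NormedAddCommGroup E] [NormedSpace ℝ E]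
  {H : Type*} [TopologicalSpace H] {I : ModelWithCorners ℝ E H}
  {M : Type*} [TopologicalSpace M] [ChartedSpace H M] [IsManifold I ∞ M]

lemma eventually_mem_chart_source (x₀ : M) : ∀ᶠ y in nhds x₀, y ∈ (chartAt H x₀).source :=
  (chartAt H x₀).open_source.mem_nhds (mem_chart_source H x₀)

lemma SmoothEnd.apply {φ : EndTensor I M} (hφ : SmoothEnd φ) {X : VField I M}
    (hX : SmoothField X) : SmoothField (fun x => φ x (X x)) :=
  fun x => (hφ x).clm_bundle_apply (hX x)

lemma SmoothOneForm.apply {α : OneTensor I M} (hα : SmoothOneForm α) {X : VField I M}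
    (hX : SmoothField X) (x : M) : ContMDiffAt I 𝓘(ℝ, ℝ) ∞ (fun y => α y (X y)) x := by
  have h := (smoothOneForm_iff_coord.1 hα x).clm_apply (smoothField_iff_coord.1 hX x)
  refine h.congr_of_eventuallyEq ?_
  filter_upwards [eventually_mem_chart_source (H := H) x] with y hy
  simp only [ContinuousLinearMap.comp_apply, coordSymm_coord hy]

lemma SmoothField.add {X Y : VField I M} (hX : SmoothField X) (hY : SmoothField Y) :
    SmoothField (fun x => X x + Y x) := by
  rw [smoothField_iff_coord] at *
  intro x
  simpa using! (hX x).add (hY x)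

lemma SmoothField.const_smul {X : VField I M} (hX : SmoothField X) (c : ℝ) :
    SmoothField (fun x => c • X x) := by
  rw [smoothField_iff_coord] at *
  intro x
  simpa using! (contMDiffAt_const (I := I) (I' := 𝓘(ℝ, ℝ)) (c := c)).smul (hX x)

lemma SmoothOneForm.add {α β : OneTensor I M} (hα : SmoothOneForm α) (hβ : SmoothOneForm β) :
    SmoothOneForm (fun x => α x + β x) := by
  rw [smoothOneForm_iff_coord] at *
  intro x
  simpa using! (hα x).add (hβ x)

lemma SmoothOneForm.const_smul {α : OneTensor I M} (hα : SmoothOneForm α) (c : ℝ) :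
    SmoothOneForm (fun x => c • α x) := by
  rw [smoothOneForm_iff_coord] at *
  intro x
  simpa using! (contMDiffAt_const (I := I) (I' := 𝓘(ℝ, ℝ)) (c := c)).smul (hα x)

/-- A coordinate vector field near a point extends to a global smooth vector field. -/
lemma exists_smoothField_eq_coordSymm [FiniteDimensional ℝ E] [T2Space M] (x₀ : M) (v : E) :
    ∃ X : VField I M, SmoothField X ∧ ∀ᶠ y in nhds x₀, X y = coordSymm I x₀ y v := by
  obtain ⟨f⟩ : Nonempty (SmoothBumpFunction I x₀) := inferInstance
  refine ⟨fun y => f y • coordSymm I x₀ y v, ?_, ?_⟩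
  · refine ContMDiffOn.smul_section_of_tsupport (V := (TangentSpace I : M → Type _))
      (s := fun y => coordSymm I x₀ y v) (ψ := f)
      (f.contMDiff.contMDiffOn) (chartAt H x₀).open_source f.tsupport_subset_chartAt_source ?_
    rw [← TangentBundle.trivializationAt_baseSet (I := I),
      Bundle.Trivialization.contMDiffOn_section_baseSet_iff]
    refine (contMDiffOn_const (c := v)).congr fun y hy => ?_
    have := coord_coordSymm (I := I) hy v
    rwa [coord, Bundle.Trivialization.continuousLinearMapAt_apply_of_mem _ _ hy] at this
  · filter_upwards [f.eventuallyEq_one] with y hy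
    simp [hy]

end Sections

/-! ### Push-forward of fields on the total space, read in a chart of the base -/

section Pushforward

variable {E : Type*} [NormedAddCommGroup E] [NormedSpace ℝ E]
  {H : Type*} [TopologicalSpace H] {I : ModelWithCorners ℝ E H}
  {M : Type*} [TopologicalSpace M] [ChartedSpace H M] [IsManifold I ∞ M]
  {E' : Type*} [NormedAddCommGroup E'] [NormedSpace ℝ E']
  {H' : Type*} [TopologicalSpace H'] {I' : ModelWithCorners ℝ E' H'}
  {P : Type*} [TopologicalSpace P] [ChartedSpace H' P] [IsManifold I' ∞ P]

variable (I) in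
/-- The push-forward of a vector field along `π`, in the coordinates of the chart at `π p₀`. -/
noncomputable def pushCoord (π : P → M) (p₀ : P) (X : VField I' P) (q : P) : E :=
  coord I (π p₀) (π q) (mfderiv I' I π q (X q))

variable {π : P → M}

variable {F : Type*} [NormedAddCommGroup F] [NormedSpace ℝ F]

lemma mvfderiv_comp_proj (hπ : ContMDiff I' I ∞ π) {h : M → F} {p : P}
    (hh : MDifferentiableAt I 𝓘(ℝ, F) h (π p)) (w : TangentSpace I' p) :
    mvfderiv I' (fun q => h (π q)) p w = mvfderiv I h (π p) (mfderiv I' I π p w) := by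
  have := mfderiv_comp p hh (hπ.mdifferentiable (by simp) p)
  exact congrArg (fun L => L w) this

/-- Tangent coordinates are the differential of the chart, so `π_* X` in coordinates is the
derivative along `X` of one fixed function, the chart composed with `π`. -/
lemma pushCoord_eventuallyEq (hπ : ContMDiff I' I ∞ π) (p₀ : P) (X : VField I' P) :
    pushCoord I π p₀ X =ᶠ[nhds p₀]
      fun q => mvfderiv I' (extChartAt I (π p₀) ∘ π) q (X q) := by
  have hc := hπ.continuous.continuousAt.eventually (eventually_mem_chart_source (H := H) (π p₀))
  filter_upwards [hc] with q hq
  rw [pushCoord, coord_eq_mvfderiv hq]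
  exact (mvfderiv_comp_proj hπ (mdifferentiableAt_extChartAt hq) (X q)).symm

lemma contMDiffAt_extChartAt_comp (hπ : ContMDiff I' I ∞ π) (p₀ : P) :
    ContMDiffAt I' 𝓘(ℝ, E) ∞ (extChartAt I (π p₀) ∘ π) p₀ :=
  (contMDiffAt_extChartAt (I := I) (x := π p₀)).comp p₀ (hπ p₀)

lemma contMDiffAt_pushCoord (hπ : ContMDiff I' I ∞ π) (p₀ : P) {X : VField I' P}
    (hX : SmoothField X) : ContMDiffAt I' 𝓘(ℝ, E) ∞ (pushCoord I π p₀ X) p₀ :=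
  (contMDiffAt_mvfderiv_apply (contMDiffAt_extChartAt_comp hπ p₀) hX).congr_of_eventuallyEq
    (pushCoord_eventuallyEq hπ p₀ X)

/-- The commutator identity for the chart composed with `π`. It gives the horizontal part of a
bracket without assuming the fields projectable. -/
lemma pushCoord_mlieBracket [I'.Boundaryless] [CompleteSpace E'] (hπ : ContMDiff I' I ∞ π)
    (p₀ : P) {X Y : VField I' P} (hX : SmoothField X) (hY : SmoothField Y) :
    pushCoord I π p₀ (VectorField.mlieBracket I' X Y) p₀
      = mvfderiv I' (pushCoord I π p₀ Y) p₀ (X p₀)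
        - mvfderiv I' (pushCoord I π p₀ X) p₀ (Y p₀) := by
  rw [(pushCoord_eventuallyEq hπ p₀ _).eq_of_nhds, mvfderiv_congr (pushCoord_eventuallyEq hπ p₀ X),
    mvfderiv_congr (pushCoord_eventuallyEq hπ p₀ Y)]
  exact mvfderiv_mlieBracket (contMDiffAt_extChartAt_comp hπ p₀) hX hY

end Pushforward
end TorusBundleST

namespace TorusBundleST

/-! ### Coordinate expressions of tensors and of the exterior derivative -/

section CoordinateTensors

variable {E : Type*} [NormedAddCommGroup E] [NormedSpace ℝ E]
  {H : Type*} [TopologicalSpace H] {I : ModelWithCorners ℝ E H}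
  {M : Type*} [TopologicalSpace M] [ChartedSpace H M] [IsManifold I ∞ M]
  {E' : Type*} [NormedAddCommGroup E'] [NormedSpace ℝ E']
  {H' : Type*} [TopologicalSpace H'] {I' : ModelWithCorners ℝ E' H'}
  {P : Type*} [TopologicalSpace P] [ChartedSpace H' P] [IsManifold I' ∞ P]

/-- A vector field in the chart at `x₀`. -/
noncomputable def fieldCoord (X : VField I M) (x₀ y : M) : E := coord I x₀ y (X y)

/-- A `1`-form in the chart at `x₀`. -/
noncomputable def formCoord (α : OneTensor I M) (x₀ y : M) : E →L[ℝ] ℝ :=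
  (α y).comp (coordSymm I x₀ y)

/-- A field of endomorphisms in the chart at `x₀`. -/
noncomputable def endCoord (φ : EndTensor I M) (x₀ y : M) : E →L[ℝ] E :=
  (coord I x₀ y).comp ((φ y).comp (coordSymm I x₀ y))

/-- A bilinear form in the chart at `x₀`. -/
noncomputable def bilinCoord (σ : TwoTensor I M) (x₀ y : M) : E →L[ℝ] E →L[ℝ] ℝ :=
  ((coordSymm I x₀ y).precomp ℝ).comp ((σ y).comp (coordSymm I x₀ y))

variable (I I') in
/-- The differential of `π` in the charts at `p₀` and `π p₀`. -/
noncomputable def mapCoord (π : P → M) (p₀ q : P) : E' →L[ℝ] E :=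
  (coord I (π p₀) (π q)).comp ((mfderiv I' I π q).comp (coordSymm I' p₀ q))

lemma formCoord_coord {α : OneTensor I M} {x₀ y : M} (hy : y ∈ (chartAt H x₀).source)
    (v : TangentSpace I y) : formCoord α x₀ y (coord I x₀ y v) = α y v := by
  simp only [formCoord, ContinuousLinearMap.comp_apply, coordSymm_coord hy]

lemma endCoord_coord {φ : EndTensor I M} {x₀ y : M} (hy : y ∈ (chartAt H x₀).source)
    (v : TangentSpace I y) : endCoord φ x₀ y (coord I x₀ y v) = coord I x₀ y (φ y v) := by
  simp only [endCoord, ContinuousLinearMap.comp_apply, coordSymm_coord hy]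

lemma bilinCoord_coord {σ : TwoTensor I M} {x₀ y : M} (hy : y ∈ (chartAt H x₀).source)
    (v w : TangentSpace I y) :
    bilinCoord σ x₀ y (coord I x₀ y v) (coord I x₀ y w) = σ y v w := by
  simp only [bilinCoord, ContinuousLinearMap.comp_apply, coordSymm_coord hy,
    ContinuousLinearMap.precomp_apply]

lemma contMDiffAt_mapCoord {π : P → M} (hπ : ContMDiff I' I ∞ π) (p₀ : P) :
    ContMDiffAt I' 𝓘(ℝ, E' →L[ℝ] E) ∞ (mapCoord I I' π p₀) p₀ :=
  ContMDiffAt.mfderiv_const (m := ∞) (hπ p₀) (by simp)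

/-- The pull-back of a `1`-form. -/
noncomputable def pullback (π : P → M) (α : OneTensor I M) : OneTensor I' P :=
  fun q => (α (π q)).comp (mfderiv I' I π q)

lemma SmoothOneForm.pullback {π : P → M} (hπ : ContMDiff I' I ∞ π) {α : OneTensor I M}
    (hα : SmoothOneForm α) : SmoothOneForm (pullback (I' := I') π α) := by
  rw [smoothOneForm_iff_coord]
  intro p₀
  have h := ((smoothOneForm_iff_coord.1 hα (π p₀)).comp p₀ (hπ p₀)).clm_comp
    (contMDiffAt_mapCoord hπ p₀)
  refine h.congr_of_eventuallyEq ?_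
  filter_upwards [hπ.continuous.continuousAt.eventually
    (eventually_mem_chart_source (H := H) (π p₀))] with q hq
  ext v
  simp only [TorusBundleST.pullback, mapCoord, ContinuousLinearMap.comp_apply, Function.comp_apply,
    coordSymm_coord hq]

/-- The exterior derivative of a pull-back, in coordinates on the base. -/
lemma dOne_pullback [I'.Boundaryless] [CompleteSpace E'] {π : P → M} (hπ : ContMDiff I' I ∞ π)
    {α : OneTensor I M} (hα : SmoothOneForm α) {X Y : VField I' P} (hX : SmoothField X)
    (hY : SmoothField Y) (p : P) :
    dOne (pullback π α) X Y p
      = mvfderiv I (formCoord α (π p)) (π p) (mfderiv I' I π p (X p)) (pushCoord I π p Y p)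
        - mvfderiv I (formCoord α (π p)) (π p) (mfderiv I' I π p (Y p)) (pushCoord I π p X p) := by
  have hα' : MDifferentiableAt I 𝓘(ℝ, E →L[ℝ] ℝ) (formCoord α (π p)) (π p) :=
    (smoothOneForm_iff_coord.1 hα (π p)).mdifferentiableAt (by simp)
  have key : ∀ Z : VField I' P, SmoothField Z → ∀ w : TangentSpace I' p,
      mvfderiv I' (fun q => pullback π α q (Z q)) p w
        = mvfderiv I (formCoord α (π p)) (π p) (mfderiv I' I π p w) (pushCoord I π p Z p)
          + formCoord α (π p) (π p) (mvfderiv I' (pushCoord I π p Z) p w) := by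
    intro Z hZ w
    have h1 : (fun q => pullback π α q (Z q))
        =ᶠ[nhds p] fun q => formCoord α (π p) (π q) (pushCoord I π p Z q) := by
      filter_upwards [hπ.continuous.continuousAt.eventually
        (eventually_mem_chart_source (H := H) (π p))] with q hq
      rw [pushCoord, formCoord_coord hq]
      rfl
    rw [mvfderiv_congr h1, mvfderiv_clm_apply (A := fun q => formCoord α (π p) (π q))
      (hα'.comp p (hπ.mdifferentiable (by simp) p))
      ((contMDiffAt_pushCoord hπ p hZ).mdifferentiableAt (by simp)), mvfderiv_comp_proj hπ hα']
  have h3 : pullback π α p (VectorField.mlieBracket I' X Y p)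
      = formCoord α (π p) (π p) (pushCoord I π p (VectorField.mlieBracket I' X Y) p) := by
    rw [pushCoord, formCoord_coord (mem_chart_source H _)]
    rfl
  -- The derivatives of the pushed-forward fields cancel against the bracket term; only derivatives
  -- of the coefficients of `α` remain.
  rw [dOne, dirDeriv_eq_mvfderiv, dirDeriv_eq_mvfderiv, key Y hY, key X hX, h3,
    pushCoord_mlieBracket hπ p hX hY, map_sub]
  ring

lemma pushCoord_id (x₀ : M) (X : VField I M) : pushCoord I (id : M → M) x₀ X = fieldCoord X x₀ := by
  funext y
  rw [pushCoord, mfderiv_id]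
  rfl

lemma contMDiffAt_fieldCoord {X : VField I M} (hX : SmoothField X) (x₀ : M) :
    ContMDiffAt I 𝓘(ℝ, E) ∞ (fieldCoord X x₀) x₀ := smoothField_iff_coord.1 hX x₀

lemma contMDiffAt_formCoord {α : OneTensor I M} (hα : SmoothOneForm α) (x₀ : M) :
    ContMDiffAt I 𝓘(ℝ, E →L[ℝ] ℝ) ∞ (formCoord α x₀) x₀ := smoothOneForm_iff_coord.1 hα x₀

lemma contMDiffAt_endCoord {φ : EndTensor I M} (hφ : SmoothEnd φ) (x₀ : M) :
    ContMDiffAt I 𝓘(ℝ, E →L[ℝ] E) ∞ (endCoord φ x₀) x₀ := smoothEnd_iff_coord.1 hφ x₀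

/-- The case `π = id` of `pushCoord_mlieBracket`. -/
lemma fieldCoord_mlieBracket [I.Boundaryless] [CompleteSpace E] (x₀ : M) {X Y : VField I M}
    (hX : SmoothField X) (hY : SmoothField Y) :
    coord I x₀ x₀ (VectorField.mlieBracket I X Y x₀)
      = mvfderiv I (fieldCoord Y x₀) x₀ (X x₀) - mvfderiv I (fieldCoord X x₀) x₀ (Y x₀) := by
  have := pushCoord_mlieBracket (π := (id : M → M)) contMDiff_id x₀ hX hY
  simp only [pushCoord_id] at this
  exact this

lemma dOne_eq_coord [I.Boundaryless] [CompleteSpace E] {α : OneTensor I M}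
    (hα : SmoothOneForm α) {X Y : VField I M} (hX : SmoothField X) (hY : SmoothField Y) (x : M) :
    dOne α X Y x
      = mvfderiv I (formCoord α x) x (X x) (coord I x x (Y x))
        - mvfderiv I (formCoord α x) x (Y x) (coord I x x (X x)) := by
  have h := dOne_pullback (π := (id : M → M)) contMDiff_id hα hX hY x
  have h1 : pullback (I' := I) (id : M → M) α = α := by
    funext y
    rw [pullback, mfderiv_id]
    rfl
  rw [h1] at h
  simp only [pushCoord_id, mfderiv_id] at h
  exact h

end CoordinateTensors
end TorusBundleST

namespace TorusBundleST

/-! ## First-order consequences of normality -/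

section NormalJet

variable {E : Type*} [NormedAddCommGroup E] [NormedSpace ℝ E]

/-- The value and the first derivative at a point of a normal almost contact structure
`(φ, ξ, η)`, in coordinates. -/
structure NormalJet (A : E →L[ℝ] E) (a : E) (e : E →L[ℝ] ℝ) (dA : E →L[ℝ] E →L[ℝ] E)
    (da : E →L[ℝ] E) (de : E →L[ℝ] E →L[ℝ] ℝ) : Prop where
  A_a : A a = 0
  e_a : e a = 1
  A_A : ∀ v, A (A v) = -v + e v • a
  dA_a : ∀ w, dA w a = -A (da w)
  de_a : ∀ w, de w a = -e (da w)
  de_A : ∀ w v, de w (A v) = -e (dA w v)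
  normal : ∀ u v, dA (A u) v - dA (A v) u + A (dA v u) - A (dA u v) + (de u v - de v u) • a = 0

namespace NormalJet

variable {A : E →L[ℝ] E} {a : E} {e : E →L[ℝ] ℝ} {dA : E →L[ℝ] E →L[ℝ] E}
  {da : E →L[ℝ] E} {de : E →L[ℝ] E →L[ℝ] ℝ}

/-- Computing `A³ v` in two ways gives `e (A v) • a = 0`, and `e a = 1`. -/
lemma e_A (J : NormalJet A a e dA da de) (v : E) : e (A v) = 0 := by
  have h := J.A_A (A v)
  rw [J.A_A v, map_add, map_neg, map_smul, J.A_a, smul_zero, add_zero] at h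
  have h2 : e (A v) • a = 0 := by simpa using h
  simpa [J.e_a] using congrArg e h2

/-- This is `dη(ξ, ·) = 0`: applying `e` to normality at `(a, v)` kills every other term, by `e ∘ A
= 0` and the derivative of `φ ξ = 0`. -/
lemma de_a_symm (J : NormalJet A a e dA da de) (v : E) : de a v = de v a := by
  have h := congrArg e (J.normal a v)
  simp only [map_add, map_sub, map_smul, J.A_a, map_zero, J.e_A, J.e_a, J.dA_a, map_neg,
    zero_apply, smul_eq_mul] at h
  linarith

/-- The Lie derivative of `φ` along the Reeb field vanishes. -/
lemma lie_A (J : NormalJet A a e dA da de) (v : E) : dA a v - da (A v) + A (da v) = 0 := by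
  have h := J.normal a v
  rw [J.de_a_symm v, sub_self, zero_smul, add_zero, J.A_a, map_zero,
    zero_apply, J.dA_a, J.dA_a] at h
  have h1 : A (dA a v - da (A v) + A (da v)) = 0 := by
    rw [map_add, map_sub]
    rw [map_neg] at h
    rw [← neg_eq_zero, ← h]
    abel
  have h2 : e (dA a v - da (A v) + A (da v)) = 0 := by
    have h3 := J.de_A a v
    have h4 := J.de_a (A v)
    have h5 := J.de_a_symm (A v)
    rw [map_add, map_sub, J.e_A]
    linarith
  -- Since `A² = -1 + e ⊗ a`, a vector killed by both `A` and `e` is zero.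
  have h3 := J.A_A (dA a v - da (A v) + A (da v))
  rw [h1, h2, map_zero, zero_smul, add_zero] at h3
  exact neg_eq_zero.1 h3.symm

/-- Invariance of `dη` under `φ`, the `e`-component of normality; `de_A` trades derivatives of `φ`
for derivatives of `η`. -/
lemma de_A_A (J : NormalJet A a e dA da de) (u v : E) :
    de (A u) (A v) - de (A v) (A u) = de u v - de v u := by
  have h := congrArg e (J.normal u v)
  have h1 := J.de_A (A u) v
  have h2 := J.de_A (A v) u
  simp only [map_add, map_sub, map_smul, map_zero, J.e_A, J.e_a, smul_eq_mul] at h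
  linarith

/-- The skew form of the invariance of `dη`, obtained by replacing `v` with `A v`; the `a`-term of
`A²` drops out because `dη(ξ, ·) = 0`. -/
lemma de_A_left (J : NormalJet A a e dA da de) (u v : E) :
    (de (A u) v - de v (A u)) + (de u (A v) - de (A v) u) = 0 := by
  have h := J.de_A_A u (A v)
  rw [J.A_A v] at h
  simp only [map_add, map_neg, map_smul, smul_eq_mul, add_apply,
    neg_apply, smul_apply, J.de_a_symm (A u)] at h
  linarith

end NormalJet

end NormalJet

/-! ### Normality of the base structure in coordinates -/

section BaseManifold

variable {E : Type*} [NormedAddCommGroup E] [NormedSpace ℝ E]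
  {H : Type*} [TopologicalSpace H] {I : ModelWithCorners ℝ E H}
  {M : Type*} [TopologicalSpace M] [ChartedSpace H M] [IsManifold I ∞ M]

lemma AlmostContactMetric.smooth_η (S : AlmostContactMetric I M) : SmoothOneForm S.η :=
  fun x => (S.g.contMDiff x).clm_bundle_apply (S.smooth_ξ x)

lemma AlmostContactMetric.η_ξ (S : AlmostContactMetric I M) (x : M) : S.η x (S.ξ x) = 1 :=
  S.unit_ξ x

lemma AlmostContactMetric.η_φ (S : AlmostContactMetric I M) (x : M) (v : TangentSpace I x) :
    S.η x (S.φ x v) = 0 := by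
  have h := S.φ_φ x (S.φ x v)
  rw [S.φ_φ x v, map_add, map_neg, map_smul, S.φ_ξ, smul_zero, add_zero] at h
  have h2 : S.η x (S.φ x v) • S.ξ x = 0 := by simpa [AlmostContactMetric.η] using h
  simpa [S.η_ξ] using congrArg (S.η x) h2

variable [I.Boundaryless] [FiniteDimensional ℝ E] [T2Space M]

lemma fieldCoord_eventuallyEq_const {X : VField I M} {x₀ : M} {v : E}
    (h : ∀ᶠ y in nhds x₀, X y = coordSymm I x₀ y v) :
    fieldCoord X x₀ =ᶠ[nhds x₀] fun _ => v := by
  filter_upwards [h, eventually_mem_chart_source (H := H) x₀] with y hy hs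
  rw [fieldCoord, hy, coord_coordSymm hs]

/-- The coordinate expression of normality. -/
lemma AlmostContactMetric.IsNormal.normalJet {S : AlmostContactMetric I M} (hS : S.IsNormal)
    (x₀ : M) :
    NormalJet (endCoord S.φ x₀ x₀) (fieldCoord S.ξ x₀ x₀) (formCoord S.η x₀ x₀)
      ((mvfderiv I (endCoord S.φ x₀) x₀).comp (coordSymm I x₀ x₀))
      ((mvfderiv I (fieldCoord S.ξ x₀) x₀).comp (coordSymm I x₀ x₀))
      ((mvfderiv I (formCoord S.η x₀) x₀).comp (coordSymm I x₀ x₀)) := by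
  have hcomp : CompleteSpace E := FiniteDimensional.complete ℝ E
  have hmem := mem_chart_source H x₀
  have hφ := (contMDiffAt_endCoord S.smooth_φ x₀).mdifferentiableAt (by simp)
  have hξ := (contMDiffAt_fieldCoord S.smooth_ξ x₀).mdifferentiableAt (by simp)
  have hη := (contMDiffAt_formCoord S.smooth_η x₀).mdifferentiableAt (by simp)
  have hsrc := eventually_mem_chart_source (H := H) x₀
  have surj : ∀ v : E, ∃ w : TangentSpace I x₀, coord I x₀ x₀ w = v :=
    fun v => ⟨_, coord_coordSymm hmem v⟩
  refine ⟨?_, ?_, ?_, ?_, ?_, ?_, ?_⟩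
  · rw [fieldCoord, endCoord_coord hmem, S.φ_ξ, map_zero]
  · rw [fieldCoord, formCoord_coord hmem, S.η_ξ]
  · intro v
    obtain ⟨w, rfl⟩ := surj v
    rw [endCoord_coord hmem, endCoord_coord hmem, S.φ_φ, formCoord_coord hmem, map_add, map_neg,
      map_smul]
    rfl
  -- This and the next two fields are the derivatives of `φ ξ = 0`, `η(ξ) = 1` and `η ∘ φ = 0`,
  -- which hold near `x₀`.
  · intro w
    have h0 : (fun y => endCoord S.φ x₀ y (fieldCoord S.ξ x₀ y)) =ᶠ[nhds x₀] fun _ => 0 := by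
      filter_upwards [hsrc] with y hy
      rw [fieldCoord, endCoord_coord hy, S.φ_ξ, map_zero]
    have h1 := mvfderiv_clm_apply hφ hξ (coordSymm I x₀ x₀ w)
    rw [mvfderiv_congr h0, mvfderiv_const] at h1
    exact eq_neg_of_add_eq_zero_left h1.symm
  · intro w
    have h0 : (fun y => formCoord S.η x₀ y (fieldCoord S.ξ x₀ y)) =ᶠ[nhds x₀] fun _ => 1 := by
      filter_upwards [hsrc] with y hy
      rw [fieldCoord, formCoord_coord hy, S.η_ξ]
    have h1 := mvfderiv_clm_apply hη hξ (coordSymm I x₀ x₀ w)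
    rw [mvfderiv_congr h0, mvfderiv_const] at h1
    exact eq_neg_of_add_eq_zero_left h1.symm
  · intro w v
    have h0 : (fun y => formCoord S.η x₀ y (endCoord S.φ x₀ y v)) =ᶠ[nhds x₀] fun _ => 0 := by
      filter_upwards [hsrc] with y hy
      rw [← coord_coordSymm (I := I) hy v, endCoord_coord hy, formCoord_coord hy, S.η_φ]
    have h2 := mvfderiv_clm_apply hφ (mdifferentiableAt_const (c := v)) (coordSymm I x₀ x₀ w)
    have h1 := mvfderiv_clm_apply hη (hφ.clm_apply (mdifferentiableAt_const (c := v)))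
      (coordSymm I x₀ x₀ w)
    rw [mvfderiv_congr h0, mvfderiv_const, h2] at h1
    simp only [mvfderiv_const, zero_apply, map_zero, add_zero] at h1
    exact eq_neg_of_add_eq_zero_left h1.symm
  · intro u v
    -- For fields with constant coordinates near `x₀`, `[U, V]` vanishes at `x₀` and the other
    -- brackets involve only derivatives of `φ`.
    obtain ⟨U, hU, hUc⟩ := exists_smoothField_eq_coordSymm (I := I) x₀ u
    obtain ⟨V, hV, hVc⟩ := exists_smoothField_eq_coordSymm (I := I) x₀ v
    have hφU : SmoothField (S.applyφ U) := S.smooth_φ.apply hU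
    have hφV : SmoothField (S.applyφ V) := S.smooth_φ.apply hV
    have dconst : ∀ {X : VField I M} {c : E}, (∀ᶠ y in nhds x₀, X y = coordSymm I x₀ y c) →
        mvfderiv I (fieldCoord X x₀) x₀ = 0 := fun h => by
      rw [mvfderiv_congr (fieldCoord_eventuallyEq_const h), mvfderiv_const]
    have dφ : ∀ {X : VField I M} {c : E}, (∀ᶠ y in nhds x₀, X y = coordSymm I x₀ y c) →
        ∀ w, mvfderiv I (fieldCoord (S.applyφ X) x₀) x₀ w
          = mvfderiv I (endCoord S.φ x₀) x₀ w c := fun {X c} h w => by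
      have h0 : fieldCoord (S.applyφ X) x₀ =ᶠ[nhds x₀] fun y => endCoord S.φ x₀ y c := by
        filter_upwards [h, hsrc] with y hy hs
        rw [fieldCoord, AlmostContactMetric.applyφ, hy, ← endCoord_coord hs, coord_coordSymm hs]
      rw [mvfderiv_congr h0, mvfderiv_clm_apply hφ (mdifferentiableAt_const (c := c)),
        mvfderiv_const]
      simp
    have vφ : ∀ {X : VField I M} {c : E}, (∀ᶠ y in nhds x₀, X y = coordSymm I x₀ y c) →
        S.applyφ X x₀ = coordSymm I x₀ x₀ (endCoord S.φ x₀ x₀ c) := fun {X c} h => by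
      simp only [AlmostContactMetric.applyφ, h.self_of_nhds, endCoord,
        ContinuousLinearMap.comp_apply, coordSymm_coord hmem]
    have h := congrArg (coord I x₀ x₀) (hS U V hU hV x₀)
    simp only [AlmostContactMetric.sasakiHatakeyama, map_add, map_sub, map_smul, map_zero,
      ← endCoord_coord hmem] at h
    rw [fieldCoord_mlieBracket x₀ hφU hφV, fieldCoord_mlieBracket x₀ hU hV,
      fieldCoord_mlieBracket x₀ hφU hV, fieldCoord_mlieBracket x₀ hU hφV,
      dOne_eq_coord S.smooth_η hU hV, dconst hUc, dconst hVc, dφ hUc, dφ hVc, dφ hUc, dφ hVc,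
      vφ hUc, vφ hVc, hUc.self_of_nhds, hVc.self_of_nhds, coord_coordSymm hmem,
      coord_coordSymm hmem] at h
    simp only [zero_apply, sub_zero, map_zero, add_zero, zero_sub, map_neg,
      sub_neg_eq_add] at h
    exact h

end BaseManifold
end TorusBundleST

namespace TorusBundleST

/-! ## Connections with prescribed curvature -/

section LinearCombination

variable {E : Type*} [NormedAddCommGroup E] [NormedSpace ℝ E]
  {H : Type*} [TopologicalSpace H] {I : ModelWithCorners ℝ E H}
  {M : Type*} [TopologicalSpace M] [ChartedSpace H M] [IsManifold I ∞ M]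

lemma dOne_linearCombination {α β : OneTensor I M} (hα : SmoothOneForm α) (hβ : SmoothOneForm β)
    (a b : ℝ) {X Y : VField I M} (hX : SmoothField X) (hY : SmoothField Y) (x : M) :
    dOne (fun x => a • α x + b • β x) X Y x = a * dOne α X Y x + b * dOne β X Y x := by
  have key : ∀ {Z : VField I M}, SmoothField Z → ∀ w : TangentSpace I x,
      mvfderiv I (fun y => (a • α y + b • β y) (Z y)) x w
        = a * mvfderiv I (fun y => α y (Z y)) x w + b * mvfderiv I (fun y => β y (Z y)) x w := by
    intro Z hZ w
    have h1 := (hα.apply hZ x).mdifferentiableAt (by simp)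
    have h2 := (hβ.apply hZ x).mdifferentiableAt (by simp)
    have h3 := mvfderiv_clm_apply_const (I := I)
      (a • ContinuousLinearMap.fst ℝ ℝ ℝ + b • ContinuousLinearMap.snd ℝ ℝ ℝ)
      (h1.prodMk_space h2) w
    have h4 := mvfderiv_clm_apply_const (I := I) (ContinuousLinearMap.fst ℝ ℝ ℝ)
      (h1.prodMk_space h2) w
    have h5 := mvfderiv_clm_apply_const (I := I) (ContinuousLinearMap.snd ℝ ℝ ℝ)
      (h1.prodMk_space h2) w
    simp only [ContinuousLinearMap.coe_fst', ContinuousLinearMap.coe_snd'] at h4 h5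
    rw [h4, h5]
    exact h3
  simp only [dOne, dirDeriv_eq_mvfderiv, key hX, key hY]
  simp only [add_apply, smul_apply, smul_eq_mul]
  ring

end LinearCombination

section Existence

variable {E : Type*} [NormedAddCommGroup E] [NormedSpace ℝ E]
  {H : Type*} [TopologicalSpace H] {I : ModelWithCorners ℝ E H} [I.Boundaryless]
  {M : Type*} [TopologicalSpace M] [ChartedSpace H M] [IsManifold I ∞ M]
  {E' : Type*} [NormedAddCommGroup E'] [NormedSpace ℝ E']
  {H' : Type*} [TopologicalSpace H'] {I' : ModelWithCorners ℝ E' H'} [I'.Boundaryless]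
  {P : Type*} [TopologicalSpace P] [ChartedSpace H' P] [IsManifold I' ∞ P]

/-- Passing from fields to single vectors is necessary: it will be applied to projections of vectors
of `P`, which do not come from fields on `M`. Every vector extends to a smooth field. -/
lemma sub_eq_coord_of_eq_dOne [FiniteDimensional ℝ E] [T2Space M] {σ τ : TwoTensor I M}
    {α : OneTensor I M} (hα : SmoothOneForm α)
    (h : ∀ X Y : VField I M, SmoothField X → SmoothField Y →
      ∀ x : M, σ x (X x) (Y x) - τ x (X x) (Y x) = dOne α X Y x)
    (x : M) (v w : TangentSpace I x) :
    σ x v w - τ x v w = mvfderiv I (formCoord α x) x v (coord I x x w)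
      - mvfderiv I (formCoord α x) x w (coord I x x v) := by
  have hcomp : CompleteSpace E := FiniteDimensional.complete ℝ E
  have hext : ∀ u : TangentSpace I x, ∃ X : VField I M, SmoothField X ∧ X x = u := by
    intro u
    obtain ⟨X, hX, hXu⟩ := exists_smoothField_eq_coordSymm (I := I) x (coord I x x u)
    exact ⟨X, hX, by rw [hXu.self_of_nhds, coordSymm_coord (mem_chart_source H x)]⟩
  obtain ⟨X, hX, rfl⟩ := hext v
  obtain ⟨Y, hY, rfl⟩ := hext w
  rw [h X Y hX hY, dOne_eq_coord hα hX hY]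

/-- The factor `2π` compensates for the `1 / 2π` in the normalization of the curvature. -/
lemma HasCurvature.add_pullback [FiniteDimensional ℝ E] [FiniteDimensional ℝ E'] [T2Space M]
    {π : P → M} (hπ : ContMDiff I' I ∞ π) {β : OneTensor I' P} (hβ : SmoothOneForm β)
    {σ τ : TwoTensor I M} (hc : HasCurvature π β τ) {α : OneTensor I M} (hα : SmoothOneForm α)
    (h : ∀ X Y : VField I M, SmoothField X → SmoothField Y →
      ∀ x : M, σ x (X x) (Y x) - τ x (X x) (Y x) = dOne α X Y x) :
    HasCurvature π (fun p => (1 : ℝ) • β p + (2 * Real.pi) • pullback (I' := I') π α p) σ := by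
  have hcomp : CompleteSpace E' := FiniteDimensional.complete ℝ E'
  intro X Y hX hY p
  rw [dOne_linearCombination hβ (hα.pullback hπ) _ _ hX hY, dOne_pullback hπ hα hX hY,
    pushCoord, pushCoord, ← sub_eq_coord_of_eq_dOne hα h, mul_add, one_mul, hc X Y hX hY]
  field_simp
  ring

lemma mfderiv_proj_smul [MulAction Torus P] {π : P → M} (hπ : IsPrincipalTorusBundle I I' π)
    (a : Torus) (p : P) (v : TangentSpace I' p) :
    (mfderiv I' I π (a • p) (mfderiv I' I' (fun q : P => a • q) p v) : E)
      = (mfderiv I' I π p v : E) := by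
  have hsm : ContMDiff I' I' ∞ (fun q : P => a • q) :=
    hπ.smooth_act.comp (contMDiff_const.prodMk contMDiff_id)
  have h1 := mfderiv_comp p (hπ.smooth_proj.mdifferentiable (by simp) (a • p))
    (hsm.mdifferentiable (by simp) p)
  have h2 : π ∘ (fun q : P => a • q) = π := funext (hπ.proj_act a)
  have h3 := congrArg (fun L : E' →L[ℝ] E => L v) h1
  rw [h2] at h3
  exact h3.symm

lemma pullback_smul [MulAction Torus P] {π : P → M} (hπ : IsPrincipalTorusBundle I I' π)
    (α : OneTensor I M) (a : Torus) (p : P) (v : TangentSpace I' p) :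
    pullback (I' := I') π α (a • p) (mfderiv I' I' (fun q : P => a • q) p v)
      = pullback (I' := I') π α p v := by
  have h := mfderiv_proj_smul hπ a p v
  -- `π (a • p) = π p` is only a propositional equality, so the tangent spaces are all read as `E`
  -- before the base point is replaced.
  have h2 : ∀ (x y : M) (u w : E), x = y → u = w →
      (α x : E →L[ℝ] ℝ) u = (α y : E →L[ℝ] ℝ) w := by
    rintro x _ u _ rfl rfl
    rfl
  exact h2 _ _ _ _ (hπ.proj_act a p) h

lemma contMDiff_torusCurve (a b : ℝ) :
    ContMDiff 𝓘(ℝ, ℝ) torusModel ∞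
      (fun t : ℝ => ((Circle.exp (a * t), Circle.exp (b * t)) : Torus)) := by
  have hmul : ∀ c : ℝ, ContMDiff 𝓘(ℝ, ℝ) (𝓡 1) ∞ (fun t : ℝ => Circle.exp (c * t)) := fun c =>
    (contMDiff_circleExp (m := ∞)).comp (contDiff_const.mul contDiff_id).contMDiff
  exact (hmul a).prodMk (hmul b)

/-- The orbit curve stays in one fibre, so its composite with `π` is constant. -/
lemma mfderiv_fundamentalField [MulAction Torus P] {π : P → M}
    (hπ : IsPrincipalTorusBundle I I' π) (a b : ℝ) (p : P) :
    mfderiv I' I π p (fundamentalField I' a b p) = 0 := by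
  let γ : ℝ → P := fun t => ((Circle.exp (a * t), Circle.exp (b * t)) : Torus) • p
  have hγ : ContMDiff 𝓘(ℝ, ℝ) I' ∞ γ :=
    hπ.smooth_act.comp ((contMDiff_torusCurve a b).prodMk contMDiff_const)
  have hγ0 : γ 0 = p := by simp [γ, ← Prod.one_eq_mk]
  have h1 := mfderiv_comp (0 : ℝ) (hπ.smooth_proj.mdifferentiable (by simp) (γ 0))
    (hγ.mdifferentiable (by simp) 0)
  have h2 : π ∘ γ = fun _ => π p := funext fun t => hπ.proj_act _ p
  have h3 := congrArg (fun L : ℝ →L[ℝ] E => L 1) h1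
  rw [h2, mfderiv_const] at h3
  have h4 : ∀ (x y : P) (u : E'), x = y →
      (mfderiv I' I π x : E' →L[ℝ] E) u = (mfderiv I' I π y : E' →L[ℝ] E) u := by
    rintro x _ u rfl
    rfl
  exact ((h4 _ _ _ hγ0).symm.trans h3.symm :)

/-- The fundamental vector fields are smooth. -/
lemma smoothField_fundamentalField [MulAction Torus P] {π : P → M}
    (hπ : IsPrincipalTorusBundle I I' π) (a b : ℝ) :
    SmoothField (fundamentalField I' a b : VField I' P) := by
  let f : P → ℝ → P := fun p t => ((Circle.exp (a * t), Circle.exp (b * t)) : Torus) • p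
  have hf : ContMDiff (I'.prod 𝓘(ℝ, ℝ)) I' ∞ (Function.uncurry f) :=
    hπ.smooth_act.comp (((contMDiff_torusCurve a b).comp contMDiff_snd).prodMk contMDiff_fst)
  have hf0 : ∀ p, f p 0 = p := fun p => by simp [f, ← Prod.one_eq_mk]
  intro p₀
  -- The partial derivative in `t` at `0` of the smooth map `(p, t) ↦ f p t` depends smoothly on
  -- `p`.
  have h1 := ContMDiffAt.mfderiv (m := ∞) f (fun _ => (0 : ℝ)) (hf (p₀, 0)) contMDiffAt_const
    (by simp)
  have h2 : ContMDiffAt I' (𝓘(ℝ, ℝ).prod 𝓘(ℝ, ℝ)) ∞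
      (fun _ : P => (⟨0, 1⟩ : TangentBundle 𝓘(ℝ, ℝ) ℝ)) p₀ := contMDiffAt_const
  have h3 := ContMDiffAt.clm_apply_of_inCoordinates (b₁ := fun _ => (0 : ℝ))
    (b₂ := fun p => f p 0) h1 h2 (by simpa only [hf0] using! contMDiffAt_id)
  have h4 : ∀ (x y : P) (u : E'), x = y →
      (⟨x, u⟩ : TangentBundle I' P) = ⟨y, u⟩ := by
    rintro x _ u rfl
    rfl
  refine h3.congr_of_eventuallyEq (Filter.Eventually.of_forall fun p => ?_)
  exact (h4 _ _ _ (hf0 p)).symm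

/-- Connection forms are an affine space over the invariant forms that vanish on vertical vectors,
and pull-backs from `M` are such forms. -/
lemma IsConnection.add_pullback [MulAction Torus P] {π : P → M}
    (hπ : IsPrincipalTorusBundle I I' π) {ω₁ ω₂ : OneTensor I' P} (hω : IsConnection ω₁ ω₂)
    {α₁ α₂ : OneTensor I M} (hα₁ : SmoothOneForm α₁) (hα₂ : SmoothOneForm α₂) (c : ℝ) :
    IsConnection (fun p => (1 : ℝ) • ω₁ p + c • pullback (I' := I') π α₁ p)
      (fun p => (1 : ℝ) • ω₂ p + c • pullback (I' := I') π α₂ p) := by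
  have hz : ∀ (α : OneTensor I M) (a b : ℝ) (p : P),
      pullback (I' := I') π α p (fundamentalField I' a b p) = 0 := fun α a b p => by
    rw [pullback, ContinuousLinearMap.comp_apply, mfderiv_fundamentalField hπ, map_zero]
  constructor
  · exact (hω.smooth₁.const_smul 1).add ((hα₁.pullback hπ.smooth_proj).const_smul c)
  · exact (hω.smooth₂.const_smul 1).add ((hα₂.pullback hπ.smooth_proj).const_smul c)
  · intro p; simpa [fundX₁, hz] using hω.fund₁₁ p
  · intro p; simpa [fundX₂, hz] using hω.fund₁₂ p
  · intro p; simpa [fundX₁, hz] using hω.fund₂₁ p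
  · intro p; simpa [fundX₂, hz] using hω.fund₂₂ p
  · intro a p v
    simp only [add_apply, smul_apply, hω.invariant₁, pullback_smul hπ]
  · intro a p v
    simp only [add_apply, smul_apply, hω.invariant₂, pullback_smul hπ]

/-- Every representative of the Chern classes is the curvature of a connection. -/
lemma HasChernClasses.exists_connection [FiniteDimensional ℝ E] [FiniteDimensional ℝ E']
    [T2Space M] [MulAction Torus P] {π : P → M} (hπ : IsPrincipalTorusBundle I I' π)
    {σ₁ σ₂ : TwoTensor I M} (h : HasChernClasses (I' := I') π σ₁ σ₂) :
    ∃ ω₁ ω₂ : OneTensor I' P,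
      IsConnection ω₁ ω₂ ∧ HasCurvature π ω₁ σ₁ ∧ HasCurvature π ω₂ σ₂ := by
  obtain ⟨ω₁, ω₂, τ₁, τ₂, hω, -, -, hc₁, hc₂, ⟨α₁, hα₁, h₁⟩, ⟨α₂, hα₂, h₂⟩⟩ := h
  exact ⟨_, _, hω.add_pullback hπ hα₁ hα₂ (2 * Real.pi),
    hc₁.add_pullback hπ.smooth_proj hω.smooth₁ hα₁ h₁,
    hc₂.add_pullback hπ.smooth_proj hω.smooth₂ hα₂ h₂⟩

end Existence
end TorusBundleST

namespace TorusBundleST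

/-! ## The almost contact metric structure on the total space -/

lemma isInvertible_of_injective_of_finrank_eq {V W : Type*} [NormedAddCommGroup V]
    [NormedSpace ℝ V] [NormedAddCommGroup W] [NormedSpace ℝ W] [FiniteDimensional ℝ V]
    [FiniteDimensional ℝ W] {L : V →L[ℝ] W} (hL : Function.Injective L)
    (h : Module.finrank ℝ V = Module.finrank ℝ W) : L.IsInvertible :=
  ⟨(LinearEquiv.ofInjectiveOfFinrankEq (L : V →ₗ[ℝ] W) hL h).toContinuousLinearEquiv, by
    ext v; rfl⟩

section Instances

variable {E : Type*} [NormedAddCommGroup E] [NormedSpace ℝ E]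
  {H : Type*} [TopologicalSpace H] {I : ModelWithCorners ℝ E H}
  {M : Type*} [TopologicalSpace M] [ChartedSpace H M]

instance finiteDimensional_tangentSpace [FiniteDimensional ℝ E] (x : M) :
    FiniteDimensional ℝ (TangentSpace I x) := inferInstanceAs (FiniteDimensional ℝ E)

instance t2Space_tangentSpace (x : M) : T2Space (TangentSpace I x) :=
  inferInstanceAs (T2Space E)

end Instances

/-! ### The splitting of `TP` by a vertical frame, and lifted tensors -/

section Frame

variable {E : Type*} [NormedAddCommGroup E] [NormedSpace ℝ E]
  {H : Type*} [TopologicalSpace H] {I : ModelWithCorners ℝ E H}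
  {M : Type*} [TopologicalSpace M] [ChartedSpace H M] [IsManifold I ∞ M]
  {E' : Type*} [NormedAddCommGroup E'] [NormedSpace ℝ E']
  {H' : Type*} [TopologicalSpace H'] {I' : ModelWithCorners ℝ E' H'}
  {P : Type*} [TopologicalSpace P] [ChartedSpace H' P] [IsManifold I' ∞ P]

variable (I) in
/-- A submersion `π` with two-dimensional fibres, vertical vector fields `ζ`, `χ` and `1`-forms
`α`, `β` with dual values on them. -/
structure IsVerticalFrame (π : P → M) (α β : OneTensor I' P) (ζ χ : VField I' P) : Prop where
  smooth_proj : ContMDiff I' I ∞ π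
  surjective : ∀ p, Function.Surjective (mfderiv I' I π p)
  finrank_eq : Module.finrank ℝ E' = Module.finrank ℝ E + 2
  smooth_α : SmoothOneForm α
  smooth_β : SmoothOneForm β
  smooth_ζ : SmoothField ζ
  α_ζ : ∀ p, α p (ζ p) = 1
  α_χ : ∀ p, α p (χ p) = 0
  β_ζ : ∀ p, β p (ζ p) = 0
  β_χ : ∀ p, β p (χ p) = 1
  proj_ζ : ∀ p, mfderiv I' I π p (ζ p) = 0
  proj_χ : ∀ p, mfderiv I' I π p (χ p) = 0

namespace IsVerticalFrame

variable {π : P → M} {α β : OneTensor I' P} {ζ χ : VField I' P}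

lemma exists_eq (h : IsVerticalFrame I π α β ζ χ) (p : P) (u : TangentSpace I (π p)) (a b : ℝ) :
    ∃ v : TangentSpace I' p, mfderiv I' I π p v = u ∧ α p v = a ∧ β p v = b := by
  obtain ⟨w, hw⟩ := h.surjective p u
  refine ⟨w + (a - α p w) • ζ p + (b - β p w) • χ p, ?_, ?_, ?_⟩
  · simp only [map_add, map_smul, h.proj_ζ, h.proj_χ, smul_zero, add_zero, hw]
  · simp only [map_add, map_smul, h.α_ζ, h.α_χ, smul_eq_mul]; ring
  · simp only [map_add, map_smul, h.β_ζ, h.β_χ, smul_eq_mul]; ring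

variable [FiniteDimensional ℝ E] [FiniteDimensional ℝ E']

/-- Surjectivity comes from correcting a lift by `ζ` and `χ`; injectivity then follows from the
dimension count. -/
lemma bijective (h : IsVerticalFrame I π α β ζ χ) (p : P) : Function.Bijective
    ((mfderiv I' I π p).prod ((α p).prod (β p))) := by
  have hs : Function.Surjective ((mfderiv I' I π p).prod ((α p).prod (β p))) := by
    rintro ⟨u, a, b⟩
    obtain ⟨v, h1, h2, h3⟩ := h.exists_eq p u a b
    exact ⟨v, by simp [h1, h2, h3]⟩
  have hrank : Module.finrank ℝ (TangentSpace I' p)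
      = Module.finrank ℝ (TangentSpace I (π p) × ℝ × ℝ) := by
    rw [Module.finrank_prod, Module.finrank_prod, Module.finrank_self]
    exact h.finrank_eq
  exact ⟨(LinearMap.injective_iff_surjective_of_finrank_eq_finrank
    (f := ((mfderiv I' I π p).prod ((α p).prod (β p))).toLinearMap) hrank).2 hs, hs⟩

lemma ext (h : IsVerticalFrame I π α β ζ χ) {p : P} {v w : TangentSpace I' p}
    (h1 : mfderiv I' I π p v = mfderiv I' I π p w) (h2 : α p v = α p w) (h3 : β p v = β p w) :
    v = w :=
  (h.bijective p).1 (by simp [h1, h2, h3])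

/-- The splitting of the tangent spaces of the total space. -/
noncomputable def frameEquiv (h : IsVerticalFrame I π α β ζ χ) (p : P) :
    TangentSpace I' p ≃L[ℝ] TangentSpace I (π p) × ℝ × ℝ :=
  (LinearEquiv.ofBijective ((mfderiv I' I π p).prod ((α p).prod (β p))).toLinearMap
    (h.bijective p)).toContinuousLinearEquiv

/-- The lift of a `(1, 1)`-tensor: on the splitting of `TP` it is
`(u, a, b) ↦ (φ u + b ξ, 0, -η u)`. -/
noncomputable def liftEnd (h : IsVerticalFrame I π α β ζ χ) (φ : EndTensor I M) (ξ : VField I M)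
    (η : OneTensor I M) : EndTensor I' P := fun p =>
  ((h.frameEquiv p).symm : _ →L[ℝ] TangentSpace I' p).comp
    ((((φ (π p)).comp (mfderiv I' I π p) + (β p).smulRight (ξ (π p)))).prod
      ((0 : TangentSpace I' p →L[ℝ] ℝ).prod (-((η (π p)).comp (mfderiv I' I π p)))))

variable {φ : EndTensor I M} {ξ : VField I M} {η : OneTensor I M}

lemma frameEquiv_liftEnd (h : IsVerticalFrame I π α β ζ χ) (p : P) (v : TangentSpace I' p) :
    h.frameEquiv p (h.liftEnd φ ξ η p v)
      = (φ (π p) (mfderiv I' I π p v) + β p v • ξ (π p), 0, -η (π p) (mfderiv I' I π p v)) := by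
  simp only [liftEnd, ContinuousLinearMap.comp_apply, ContinuousLinearEquiv.coe_coe,
    ContinuousLinearEquiv.apply_symm_apply]
  rfl

lemma proj_liftEnd (h : IsVerticalFrame I π α β ζ χ) (p : P) (v : TangentSpace I' p) :
    mfderiv I' I π p (h.liftEnd φ ξ η p v)
      = φ (π p) (mfderiv I' I π p v) + β p v • ξ (π p) :=
  congrArg Prod.fst (h.frameEquiv_liftEnd p v)

lemma α_liftEnd (h : IsVerticalFrame I π α β ζ χ) (p : P) (v : TangentSpace I' p) :
    α p (h.liftEnd φ ξ η p v) = 0 :=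
  congrArg (fun x => x.2.1) (h.frameEquiv_liftEnd p v)

lemma β_liftEnd (h : IsVerticalFrame I π α β ζ χ) (p : P) (v : TangentSpace I' p) :
    β p (h.liftEnd φ ξ η p v) = -η (π p) (mfderiv I' I π p v) :=
  congrArg (fun x => x.2.2) (h.frameEquiv_liftEnd p v)

/-- The splitting of `TP` in coordinates. -/
noncomputable def frameCoord (_ : IsVerticalFrame I π α β ζ χ) (p₀ q : P) :
    E' →L[ℝ] E × ℝ × ℝ :=
  (ContinuousLinearMap.inl ℝ E (ℝ × ℝ)).comp (mapCoord I I' π p₀ q)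
    + ((ContinuousLinearMap.inr ℝ E (ℝ × ℝ)).comp
        (ContinuousLinearMap.inl ℝ ℝ ℝ)).comp (formCoord α p₀ q)
    + ((ContinuousLinearMap.inr ℝ E (ℝ × ℝ)).comp
        (ContinuousLinearMap.inr ℝ ℝ ℝ)).comp (formCoord β p₀ q)

lemma contMDiffAt_frameCoord (h : IsVerticalFrame I π α β ζ χ) (p₀ : P) :
    ContMDiffAt I' 𝓘(ℝ, E' →L[ℝ] E × ℝ × ℝ) ∞ (h.frameCoord p₀) p₀ :=
  ((contMDiffAt_const.clm_comp (contMDiffAt_mapCoord h.smooth_proj p₀)).add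
    (contMDiffAt_const.clm_comp (contMDiffAt_formCoord h.smooth_α p₀))).add
    (contMDiffAt_const.clm_comp (contMDiffAt_formCoord h.smooth_β p₀))

lemma frameCoord_coord (h : IsVerticalFrame I π α β ζ χ) {p₀ q : P}
    (hq : q ∈ (chartAt H' p₀).source) (v : TangentSpace I' q) :
    h.frameCoord p₀ q (coord I' p₀ q v)
      = (coord I (π p₀) (π q) (mfderiv I' I π q v), α q v, β q v) := by
  simp [frameCoord, mapCoord, formCoord_coord hq, coordSymm_coord hq]

lemma isInvertible_frameCoord (h : IsVerticalFrame I π α β ζ χ) {p₀ q : P}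
    (hq : q ∈ (chartAt H' p₀).source) (hπq : π q ∈ (chartAt H (π p₀)).source) :
    (h.frameCoord p₀ q).IsInvertible := by
  refine isInvertible_of_injective_of_finrank_eq ?_ (by simp [h.finrank_eq])
  intro v w hvw
  rw [← coord_coordSymm (I := I') hq v, ← coord_coordSymm (I := I') hq w] at hvw ⊢
  rw [frameCoord_coord h hq, frameCoord_coord h hq, Prod.mk.injEq, Prod.mk.injEq] at hvw
  congr 1
  refine h.ext ?_ hvw.2.1 hvw.2.2
  have := congrArg (coordSymm I (π p₀) (π q)) hvw.1
  rwa [coordSymm_coord hπq, coordSymm_coord hπq] at this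

/-- In charts the lift is `L⁻¹ B L` with `L` the splitting `frameCoord`; both `L` and `B` are
smooth, and inversion is smooth at invertible operators. -/
lemma smooth_liftEnd (h : IsVerticalFrame I π α β ζ χ) (hφ : SmoothEnd φ) (hξ : SmoothField ξ)
    (hη : SmoothOneForm η) : SmoothEnd (h.liftEnd φ ξ η) := by
  rw [smoothEnd_iff_coord]
  intro p₀
  -- The model endomorphism `(u, a, b) ↦ (φ u + b ξ, 0, -η u)` in the chart at `π p₀`.
  let B : P → E × ℝ × ℝ →L[ℝ] E × ℝ × ℝ := fun q =>
    (ContinuousLinearMap.inl ℝ E (ℝ × ℝ)).comp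
        ((endCoord φ (π p₀) (π q)).comp (ContinuousLinearMap.fst ℝ E (ℝ × ℝ))
          + ContinuousLinearMap.smulRightL ℝ (E × ℝ × ℝ) E
              ((ContinuousLinearMap.snd ℝ ℝ ℝ).comp (ContinuousLinearMap.snd ℝ E (ℝ × ℝ)))
              (fieldCoord ξ (π p₀) (π q)))
      + (-((ContinuousLinearMap.inr ℝ E (ℝ × ℝ)).comp (ContinuousLinearMap.inr ℝ ℝ ℝ))).comp
        ((formCoord η (π p₀) (π q)).comp (ContinuousLinearMap.fst ℝ E (ℝ × ℝ)))
  have hπ := h.smooth_proj p₀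
  have hB : ContMDiffAt I' 𝓘(ℝ, E × ℝ × ℝ →L[ℝ] E × ℝ × ℝ) ∞ B p₀ := by
    have h1 := (contMDiffAt_endCoord hφ (π p₀)).comp p₀ hπ
    have h2 := (contMDiffAt_fieldCoord hξ (π p₀)).comp p₀ hπ
    have h3 := (contMDiffAt_formCoord hη (π p₀)).comp p₀ hπ
    exact (contMDiffAt_const.clm_comp ((h1.clm_comp contMDiffAt_const).add
      (contMDiffAt_const.clm_apply h2))).add
      (contMDiffAt_const.clm_comp (h3.clm_comp contMDiffAt_const))
  have hinv : ContMDiffAt I' 𝓘(ℝ, E × ℝ × ℝ →L[ℝ] E') ∞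
      (fun q => (h.frameCoord p₀ q).inverse) p₀ := by
    obtain ⟨L, hL⟩ := h.isInvertible_frameCoord (mem_chart_source H' p₀)
      (mem_chart_source H (π p₀))
    have hcomp : CompleteSpace E' := FiniteDimensional.complete ℝ E'
    have h1 : ContDiffAt ℝ ∞ ContinuousLinearMap.inverse (h.frameCoord p₀ p₀) := by
      rw [← hL]
      exact contDiffAt_map_inverse L
    exact h1.contMDiffAt.comp p₀ (h.contMDiffAt_frameCoord p₀)
  refine (hinv.clm_comp (hB.clm_comp (h.contMDiffAt_frameCoord p₀))).congr_of_eventuallyEq ?_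
  filter_upwards [eventually_mem_chart_source (H := H') p₀,
    h.smooth_proj.continuous.continuousAt.eventually
      (eventually_mem_chart_source (H := H) (π p₀))] with q hq hπq
  have hi := h.isInvertible_frameCoord hq hπq
  ext1 v
  obtain ⟨w, rfl⟩ : ∃ w : TangentSpace I' q, coord I' p₀ q w = v := ⟨_, coord_coordSymm hq v⟩
  apply hi.injective
  simp only [ContinuousLinearMap.comp_apply, coordSymm_coord hq, hi.self_apply_inverse]
  rw [h.frameCoord_coord hq, h.frameCoord_coord hq, h.proj_liftEnd, h.α_liftEnd, h.β_liftEnd]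
  simp [B, endCoord_coord hπq, formCoord_coord hπq, fieldCoord]

variable (π α β) in
/-- The metric `α² + β² + π^* g`. -/
noncomputable def liftInner (g : TwoTensor I M) : TwoTensor I' P := fun p =>
  (α p).smulRight (α p) + (β p).smulRight (β p)
    + ((mfderiv I' I π p).precomp ℝ).comp ((g (π p)).comp (mfderiv I' I π p))

lemma liftInner_apply (g : TwoTensor I M) (p : P) (v w : TangentSpace I' p) :
    liftInner π α β g p v w = α p v * α p w + β p v * β p w
      + g (π p) (mfderiv I' I π p v) (mfderiv I' I π p w) := by
  simp [liftInner]

lemma contMDiff_liftInner (h : IsVerticalFrame I π α β ζ χ) {g : TwoTensor I M}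
    (hg : ContMDiff I (I.prod 𝓘(ℝ, E →L[ℝ] E →L[ℝ] ℝ)) ∞
      (fun x => Bundle.TotalSpace.mk' (E →L[ℝ] E →L[ℝ] ℝ)
        (E := fun x : M => TangentSpace I x →L[ℝ] TangentSpace I x →L[ℝ] Bundle.Trivial M ℝ x)
        x (g x))) :
    ContMDiff I' (I'.prod 𝓘(ℝ, E' →L[ℝ] E' →L[ℝ] ℝ)) ∞
      (fun x => Bundle.TotalSpace.mk' (E' →L[ℝ] E' →L[ℝ] ℝ)
        (E := fun x : P => TangentSpace I' x →L[ℝ] TangentSpace I' x →L[ℝ] Bundle.Trivial P ℝ x)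
        x (liftInner π α β g x)) := by
  rw [smoothTwoTensor_iff_coord] at hg ⊢
  intro p₀
  have h1 := (hg (π p₀)).comp p₀ (h.smooth_proj p₀)
  have h2 := contMDiffAt_mapCoord h.smooth_proj p₀
  have hsq : ∀ {γ : OneTensor I' P}, SmoothOneForm γ →
      ContMDiffAt I' 𝓘(ℝ, E' →L[ℝ] E' →L[ℝ] ℝ) ∞
        (fun q => ContinuousLinearMap.smulRightL ℝ E' (E' →L[ℝ] ℝ) (formCoord γ p₀ q)
          (formCoord γ p₀ q)) p₀ := fun hγ =>
    (contMDiffAt_const.clm_apply (contMDiffAt_formCoord hγ p₀)).clm_apply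
      (contMDiffAt_formCoord hγ p₀)
  have h3 : ContMDiffAt I' 𝓘(ℝ, E' →L[ℝ] E' →L[ℝ] ℝ) ∞
    (fun q => ((mapCoord I I' π p₀ q).precomp ℝ).comp
      ((bilinCoord g (π p₀) (π q)).comp (mapCoord I I' π p₀ q))) p₀ := by
    have h5 : ContMDiffAt I' 𝓘(ℝ, E →L[ℝ] E →L[ℝ] ℝ) ∞
      (fun q => bilinCoord g (π p₀) (π q)) p₀ := h1
    exact (ContMDiffAt.clm_precomp (F₃ := ℝ) h2).clm_comp (h5.clm_comp h2)
  have h4 := ((hsq h.smooth_α).add (hsq h.smooth_β)).add h3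
  refine h4.congr_of_eventuallyEq ?_
  filter_upwards [h.smooth_proj.continuous.continuousAt.eventually
      (eventually_mem_chart_source (H := H) (π p₀))] with q hπq
  ext v w
  have key : bilinCoord g (π p₀) (π q) (mapCoord I I' π p₀ q v) (mapCoord I I' π p₀ q w)
      = g (π q) (mfderiv I' I π q (coordSymm I' p₀ q v)) (mfderiv I' I π q (coordSymm I' p₀ q w)) :=
    bilinCoord_coord hπq _ _
  simp only [ContinuousLinearMap.comp_apply, ContinuousLinearMap.precomp_apply, liftInner_apply,
    add_apply, Pi.add_apply, key]
  rfl

end IsVerticalFrame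
end Frame
end TorusBundleST

namespace TorusBundleST

/-! ### The lifted metric and the algebraic identities -/

section TotalStructure

variable {E : Type*} [NormedAddCommGroup E] [NormedSpace ℝ E]
  {H : Type*} [TopologicalSpace H] {I : ModelWithCorners ℝ E H}
  {M : Type*} [TopologicalSpace M] [ChartedSpace H M] [IsManifold I ∞ M]
  {E' : Type*} [NormedAddCommGroup E'] [NormedSpace ℝ E']
  {H' : Type*} [TopologicalSpace H'] {I' : ModelWithCorners ℝ E' H'}
  {P : Type*} [TopologicalSpace P] [ChartedSpace H' P] [IsManifold I' ∞ P]

lemma AlmostContactMetric.inner_ξ_φ (S : AlmostContactMetric I M) (x : M) (v : TangentSpace I x) :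
    S.g.inner x (S.ξ x) (S.φ x v) = 0 := S.η_φ x v

lemma AlmostContactMetric.inner_self_nonneg (S : AlmostContactMetric I M) (x : M)
    (v : TangentSpace I x) :
    0 ≤ S.g.inner x v v := by
  by_cases hv : v = 0
  · simp [hv]
  · exact (S.g.pos x v hv).le

namespace IsVerticalFrame

variable {π : P → M} {α β : OneTensor I' P} {ζ χ : VField I' P}
  [FiniteDimensional ℝ E] [FiniteDimensional ℝ E']

lemma liftInner_pos (h : IsVerticalFrame I π α β ζ χ) (S : AlmostContactMetric I M) (p : P)
    (v : TangentSpace I' p) (hv : v ≠ 0) : 0 < liftInner π α β S.g.inner p v v := by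
  rw [liftInner_apply]
  by_contra hneg
  have h0 := S.inner_self_nonneg (π p) (mfderiv I' I π p v)
  have h1 := mul_self_nonneg (α p v)
  have h2 := mul_self_nonneg (β p v)
  have hα : α p v = 0 := mul_self_eq_zero.1 (by linarith)
  have hβ : β p v = 0 := mul_self_eq_zero.1 (by linarith)
  have hu : mfderiv I' I π p v = 0 := by
    by_contra hu
    linarith [S.g.pos (π p) _ hu]
  exact hv (h.ext (by rw [hu, map_zero]) (by rw [hα, map_zero]) (by rw [hβ, map_zero]))

/-- A sum of three nonnegative terms below `1` bounds each of them, so the unit ball lies in the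
image, under the inverse splitting, of a product of bounded sets. -/
lemma isVonNBounded_liftInner (h : IsVerticalFrame I π α β ζ χ) (S : AlmostContactMetric I M)
    (p : P) : Bornology.IsVonNBounded ℝ
      {v : TangentSpace I' p | liftInner π α β S.g.inner p v v < 1} := by
  have hI : Bornology.IsBounded (Set.Icc (-1 : ℝ) 1) := Metric.isBounded_Icc _ _
  have hM : Bornology.IsBounded ({u : E | S.g.inner (π p) u u < 1}) :=
    (NormedSpace.isVonNBounded_iff ℝ).1 (S.g.isVonNBounded (π p))
  have hprod : Bornology.IsVonNBounded ℝ
      ({u : TangentSpace I (π p) | S.g.inner (π p) u u < 1}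
        ×ˢ Set.Icc (-1 : ℝ) 1 ×ˢ Set.Icc (-1 : ℝ) 1) :=
    (NormedSpace.isVonNBounded_iff ℝ (E := E × ℝ × ℝ)).2 (hM.prod (hI.prod hI))
  have hb := hprod.image ((h.frameEquiv p).symm : _ →L[ℝ] TangentSpace I' p)
  refine hb.subset fun v hv => ?_
  refine ⟨h.frameEquiv p v, ?_, (h.frameEquiv p).symm_apply_apply v⟩
  rw [Set.mem_ofPred_eq, liftInner_apply] at hv
  have h0 := S.inner_self_nonneg (π p) (mfderiv I' I π p v)
  have h1 := mul_self_nonneg (α p v)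
  have h2 := mul_self_nonneg (β p v)
  refine ⟨?_, ?_, ?_⟩
  · change S.g.inner (π p) (mfderiv I' I π p v) (mfderiv I' I π p v) < 1
    linarith
  · exact abs_le.1 (abs_le_one_iff_mul_self_le_one.2
      (show α p v * α p v ≤ 1 by linarith))
  · exact abs_le.1 (abs_le_one_iff_mul_self_le_one.2
      (show β p v * β p v ≤ 1 by linarith))

/-- The almost contact metric structure on the total space. -/
noncomputable def totalStructure (h : IsVerticalFrame I π α β ζ χ) (S : AlmostContactMetric I M) :
    AlmostContactMetric I' P where
  g :=
    { inner := liftInner π α β S.g.inner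
      symm := fun p v w => by
        rw [liftInner_apply, liftInner_apply, S.g.symm]
        ring
      pos := h.liftInner_pos S
      isVonNBounded := h.isVonNBounded_liftInner S
      contMDiff := h.contMDiff_liftInner S.g.contMDiff }
  ξ := ζ
  φ := h.liftEnd S.φ S.ξ S.η
  smooth_ξ := h.smooth_ζ
  smooth_φ := h.smooth_liftEnd S.smooth_φ S.smooth_ξ S.smooth_η
  unit_ξ := fun p => by
    rw [liftInner_apply, h.α_ζ, h.β_ζ, h.proj_ζ]
    simp
  φ_ξ := fun p => by
    refine h.ext ?_ ?_ ?_
    · rw [h.proj_liftEnd, h.proj_ζ, h.β_ζ]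
      simp
    · rw [h.α_liftEnd, map_zero]
    · rw [h.β_liftEnd, h.proj_ζ]
      simp
  -- The summand `η(u) ξ` of `φ² u` is cancelled by the passage through `χ`, so `φ̂²` is `-1` on all
  -- of `ker α`, lifts of `ξ` included.
  φ_φ := fun p v => by
    refine h.ext ?_ ?_ ?_
    · rw [h.proj_liftEnd, h.β_liftEnd, h.proj_liftEnd, map_add, map_smul, S.φ_φ, S.φ_ξ, map_add,
        map_smul, h.proj_ζ, map_neg]
      simp [AlmostContactMetric.η]
    · rw [h.α_liftEnd, liftInner_apply, h.α_ζ, h.β_ζ, h.proj_ζ]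
      simp [h.α_ζ]
    · rw [h.β_liftEnd, h.proj_liftEnd, map_add, map_smul, S.η_φ, S.η_ξ]
      simp [h.β_ζ]
  g_φ_φ := fun p v w => by
    simp only [liftInner_apply, h.proj_liftEnd, h.α_liftEnd, h.β_liftEnd, h.α_ζ, h.β_ζ, h.proj_ζ,
      map_add, map_smul, add_apply, smul_apply, smul_eq_mul, S.g_φ_φ, S.inner_ξ_φ, S.unit_ξ,
      S.g.symm (π p) (S.φ (π p) _) (S.ξ (π p)), map_zero, zero_apply, AlmostContactMetric.η]
    ring

variable (h : IsVerticalFrame I π α β ζ χ) (S : AlmostContactMetric I M)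

lemma totalStructure_η (p : P) : (h.totalStructure S).η p = α p := by
  ext v
  change liftInner π α β S.g.inner p (ζ p) v = α p v
  rw [liftInner_apply, h.α_ζ, h.β_ζ, h.proj_ζ]
  simp

lemma totalStructure_inner (p : P) (v w : TangentSpace I' p) :
    (h.totalStructure S).g.inner p v w = α p v * α p w + β p v * β p w
      + S.g.inner (π p) (mfderiv I' I π p v) (mfderiv I' I π p w) :=
  liftInner_apply S.g.inner p v w

lemma totalStructure_φ (p : P) (v : TangentSpace I' p) :
    (h.totalStructure S).φ p v = h.liftEnd S.φ S.ξ S.η p v := rfl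

end IsVerticalFrame

end TotalStructure

/-! ### Pointwise identities behind normality of the lift -/

namespace NormalJet

variable {E : Type*} [NormedAddCommGroup E] [NormedSpace ℝ E]
  {A : E →L[ℝ] E} {a : E} {e : E →L[ℝ] ℝ} {dA : E →L[ℝ] E →L[ℝ] E}
  {da : E →L[ℝ] E} {de : E →L[ℝ] E →L[ℝ] ℝ}

/-- The horizontal component of the Sasaki-Hatakeyama tensor of the total space. -/
lemma horizontal_eq_zero (J : NormalJet A a e dA da de) (u v p₁ p₂ q₁ q₂ : E)
    (r r' s₁ s₂ s₃ s₄ b₂ b₃ : ℝ)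
    (hb : b₂ + b₃ = s₁ - s₂ + de v u - de u v + e q₂ - e q₁) :
    ((dA (A u + r • a) v + A p₁ + s₁ • a + r' • da (A u + r • a))
      - (dA (A v + r' • a) u + A p₂ + s₂ • a + r • da (A v + r' • a)))
      - (q₁ - q₂)
      - (A (p₁ - (dA v u + A q₂ + s₄ • a + r • da v)) + b₂ • a)
      - (A ((dA u v + A q₁ + s₃ • a + r' • da u) - p₂) + b₃ • a) = 0 := by
  have h1 := J.normal u v
  have h2 := J.lie_A v
  have h3 := J.lie_A u
  obtain rfl : b₂ = s₁ - s₂ + de v u - de u v + e q₂ - e q₁ - b₃ := by linarith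
  simp only [map_add, map_sub, map_smul, add_apply, smul_apply, J.A_A, J.A_a, smul_zero]
  -- Normality at `(u, v)` handles the horizontal arguments; `L_ξ φ = 0` handles the `ξ`-parts `r •
  -- a`, `r' • a` that `φ̂` creates from `χ`.
  linear_combination (norm := module) h1 + r • h2 - r' • h3

/-- The component along the second vertical field of the Sasaki-Hatakeyama tensor of the total
space. -/
lemma vertical_eq_zero (J : NormalJet A a e dA da de) (u v p₁ p₂ q₁ q₂ : E)
    (r r' s₃ s₄ : ℝ) :
    (-(de (A u + r • a) v + e p₁) + (de (A v + r' • a) u + e p₂)) - (s₃ - s₄)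
      + e (p₁ - (dA v u + A q₂ + s₄ • a + r • da v))
      + e ((dA u v + A q₁ + s₃ • a + r' • da u) - p₂) = 0 := by
  have h1 := J.de_A_left u v
  have h2 := J.de_A u v
  have h3 := J.de_A v u
  have h4 := J.de_a u
  have h5 := J.de_a v
  simp only [map_add, map_sub, map_smul, add_apply, smul_apply, smul_eq_mul, J.e_A, J.e_a,
    J.de_a_symm]
  linear_combination -h1 + h2 - h3 + r' * h4 - r * h5

end NormalJet
end TorusBundleST

namespace TorusBundleST

/-! ### Invariant forms on the base -/

section Invariance

variable {E : Type*} [NormedAddCommGroup E] [NormedSpace ℝ E]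
  {H : Type*} [TopologicalSpace H] {I : ModelWithCorners ℝ E H}
  {M : Type*} [TopologicalSpace M] [ChartedSpace H M] [IsManifold I ∞ M]
  {S : AlmostContactMetric I M} {σ : TwoTensor I M}

lemma AlmostContactMetric.Invariant.ξ_left (hσ : S.Invariant σ) (x : M) (v : TangentSpace I x) :
    σ x (S.ξ x) v = 0 := by
  rw [← hσ, S.φ_ξ]
  simp

lemma AlmostContactMetric.Invariant.ξ_right (hσ : S.Invariant σ) (x : M) (v : TangentSpace I x) :
    σ x v (S.ξ x) = 0 := by
  rw [← hσ, S.φ_ξ]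
  simp

/-- Invariance applied to `(φ v, w)`, where the `ξ`-term of `φ²` contributes nothing. -/
lemma AlmostContactMetric.Invariant.φ_left (hσ : S.Invariant σ) (x : M)
    (v w : TangentSpace I x) : σ x (S.φ x v) w = -σ x v (S.φ x w) := by
  rw [← hσ x (S.φ x v) w, S.φ_φ]
  simp [hσ.ξ_left]

lemma AlmostContactMetric.Invariant.linearCombination {σ₁ σ₂ : TwoTensor I M}
    (h₁ : S.Invariant σ₁) (h₂ : S.Invariant σ₂) (a b : ℝ) :
    S.Invariant (fun x => a • σ₁ x + b • σ₂ x) := by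
  intro x v w
  simp [h₁ x v w, h₂ x v w]

end Invariance

/-! ### Normality of the total structure -/

section Normality

variable {E : Type*} [NormedAddCommGroup E] [NormedSpace ℝ E]
  {H : Type*} [TopologicalSpace H] {I : ModelWithCorners ℝ E H} [I.Boundaryless]
  {M : Type*} [TopologicalSpace M] [ChartedSpace H M] [IsManifold I ∞ M]
  {E' : Type*} [NormedAddCommGroup E'] [NormedSpace ℝ E']
  {H' : Type*} [TopologicalSpace H'] {I' : ModelWithCorners ℝ E' H'} [I'.Boundaryless]
  {P : Type*} [TopologicalSpace P] [ChartedSpace H' P] [IsManifold I' ∞ P]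
  [FiniteDimensional ℝ E] [FiniteDimensional ℝ E']

variable (I) in
/-- The `1`-form `α` satisfies `dα = π^* κ`. -/
def HasExteriorDerivative (π : P → M) (α : OneTensor I' P) (κ : TwoTensor I M) : Prop :=
  ∀ X Y : VField I' P, SmoothField X → SmoothField Y → ∀ p : P,
    dOne α X Y p = κ (π p) (mfderiv I' I π p (X p)) (mfderiv I' I π p (Y p))

lemma HasExteriorDerivative.apply_mlieBracket {π : P → M} {α : OneTensor I' P}
    {κ : TwoTensor I M} (h : HasExteriorDerivative I π α κ) {X Y : VField I' P}
    (hX : SmoothField X) (hY : SmoothField Y) (p : P) :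
    α p (VectorField.mlieBracket I' X Y p)
      = mvfderiv I' (fun q => α q (Y q)) p (X p) - mvfderiv I' (fun q => α q (X q)) p (Y p)
        - κ (π p) (mfderiv I' I π p (X p)) (mfderiv I' I π p (Y p)) := by
  rw [← h X Y hX hY p, dOne, dirDeriv_eq_mvfderiv, dirDeriv_eq_mvfderiv]
  ring

namespace IsVerticalFrame

variable {π : P → M} {α β : OneTensor I' P} {ζ χ : VField I' P}
  (h : IsVerticalFrame I π α β ζ χ) (S : AlmostContactMetric I M)

/-- The derivative is written through the chart at `π p` so that it matches the operators appearing
in `normalJet`. -/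
lemma mvfderiv_proj {F : Type*} [NormedAddCommGroup F] [NormedSpace ℝ F]
    (h : IsVerticalFrame I π α β ζ χ) {f : M → F} {p : P}
    (hf : MDifferentiableAt I 𝓘(ℝ, F) f (π p)) (w : TangentSpace I' p) :
    mvfderiv I' (fun q => f (π q)) p w
      = (mvfderiv I f (π p)).comp (coordSymm I (π p) (π p))
        (coord I (π p) (π p) (mfderiv I' I π p w)) := by
  rw [mvfderiv_comp_proj h.smooth_proj hf, ContinuousLinearMap.comp_apply,
    coordSymm_coord (mem_chart_source H (π p))]

lemma eventually_proj_mem (h : IsVerticalFrame I π α β ζ χ) (p : P) :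
    ∀ᶠ q in nhds p, π q ∈ (chartAt H (π p)).source :=
  h.smooth_proj.continuous.continuousAt.eventually (eventually_mem_chart_source (H := H) (π p))

lemma mdifferentiableAt_comp_proj {F : Type*} [NormedAddCommGroup F] [NormedSpace ℝ F]
    (h : IsVerticalFrame I π α β ζ χ) {f : M → F} {p : P}
    (hf : MDifferentiableAt I 𝓘(ℝ, F) f (π p)) :
    MDifferentiableAt I' 𝓘(ℝ, F) (fun q => f (π q)) p :=
  hf.comp p (h.smooth_proj.mdifferentiable (by simp) p)

/-- The derivative of the push-forward of `φ̂ X`. -/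
lemma mvfderiv_pushCoord_applyφ {X : VField I' P} (hX : SmoothField X) (p : P)
    (w : TangentSpace I' p) :
    mvfderiv I' (pushCoord I π p ((h.totalStructure S).applyφ X)) p w
      = ((mvfderiv I (endCoord S.φ (π p)) (π p)).comp (coordSymm I (π p) (π p)))
          (coord I (π p) (π p) (mfderiv I' I π p w)) (pushCoord I π p X p)
        + endCoord S.φ (π p) (π p) (mvfderiv I' (pushCoord I π p X) p w)
        + mvfderiv I' (fun q => β q (X q)) p w • fieldCoord S.ξ (π p) (π p)
        + β p (X p) • ((mvfderiv I (fieldCoord S.ξ (π p)) (π p)).comp (coordSymm I (π p) (π p)))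
            (coord I (π p) (π p) (mfderiv I' I π p w)) := by
  have hφ := (contMDiffAt_endCoord S.smooth_φ (π p)).mdifferentiableAt (by simp)
  have hξ := (contMDiffAt_fieldCoord S.smooth_ξ (π p)).mdifferentiableAt (by simp)
  have hu := (contMDiffAt_pushCoord h.smooth_proj p hX).mdifferentiableAt (by simp)
  have hβ := (h.smooth_β.apply hX p).mdifferentiableAt (by simp)
  have h0 : pushCoord I π p ((h.totalStructure S).applyφ X) =ᶠ[nhds p]
      fun q => endCoord S.φ (π p) (π q) (pushCoord I π p X q)
        + β q (X q) • fieldCoord S.ξ (π p) (π q) := by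
    filter_upwards [h.eventually_proj_mem p] with q hq
    rw [pushCoord, pushCoord, endCoord_coord hq, AlmostContactMetric.applyφ, fieldCoord, ← map_smul,
      ← map_add]
    exact congrArg _ (h.proj_liftEnd q (X q))
  have hφ' := h.mdifferentiableAt_comp_proj hφ
  have hξ' := h.mdifferentiableAt_comp_proj hξ
  rw [mvfderiv_congr h0, mvfderiv_fun_add (hφ'.clm_apply hu) (hβ.fun_smul hξ'),
    mvfderiv_fun_smul hβ hξ', add_apply, mvfderiv_clm_apply hφ' hu, h.mvfderiv_proj hφ]
  simp only [add_apply, smul_apply, ContinuousLinearMap.smulRight_apply, h.mvfderiv_proj hξ]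
  abel

/-- The derivative of `β (φ̂ X)`. -/
lemma mvfderiv_β_applyφ {X : VField I' P} (hX : SmoothField X) (p : P) (w : TangentSpace I' p) :
    mvfderiv I' (fun q => β q ((h.totalStructure S).applyφ X q)) p w
      = -(((mvfderiv I (formCoord S.η (π p)) (π p)).comp (coordSymm I (π p) (π p)))
          (coord I (π p) (π p) (mfderiv I' I π p w)) (pushCoord I π p X p)
        + formCoord S.η (π p) (π p) (mvfderiv I' (pushCoord I π p X) p w)) := by
  have hη := (contMDiffAt_formCoord S.smooth_η (π p)).mdifferentiableAt (by simp)
  have hu := (contMDiffAt_pushCoord h.smooth_proj p hX).mdifferentiableAt (by simp)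
  have h0 : (fun q => β q ((h.totalStructure S).applyφ X q)) =ᶠ[nhds p]
      fun q => -(formCoord S.η (π p) (π q) (pushCoord I π p X q)) := by
    filter_upwards [h.eventually_proj_mem p] with q hq
    rw [pushCoord, formCoord_coord hq]
    exact h.β_liftEnd q (X q)
  rw [mvfderiv_congr h0, mvfderiv_fun_neg, neg_apply,
    mvfderiv_clm_apply (h.mdifferentiableAt_comp_proj hη) hu, h.mvfderiv_proj hη]

lemma mvfderiv_α_applyφ (X : VField I' P) (p : P) (w : TangentSpace I' p) :
    mvfderiv I' (fun q => α q ((h.totalStructure S).applyφ X q)) p w = 0 := by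
  have h0 : (fun q => α q ((h.totalStructure S).applyφ X q)) = fun _ => 0 :=
    funext fun q => h.α_liftEnd q (X q)
  rw [h0, mvfderiv_const, zero_apply]

variable [T2Space M]

/-- The structure on the total space is normal. -/
lemma isNormal_totalStructure {S : AlmostContactMetric I M} (hS : S.IsNormal)
    {κ₁ κ₂ : TwoTensor I M} (hα : HasExteriorDerivative I π α κ₁)
    (hβ : HasExteriorDerivative I π β κ₂) (h₁ : S.Invariant κ₁) (h₂ : S.Invariant κ₂) :
    (h.totalStructure S).IsNormal := by
  have hcomp : CompleteSpace E' := FiniteDimensional.complete ℝ E'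
  intro X Y hX hY p
  have hmem := mem_chart_source H (π p)
  have J := hS.normalJet (π p)
  have hφX : SmoothField ((h.totalStructure S).applyφ X) := (h.totalStructure S).smooth_φ.apply hX
  have hφY : SmoothField ((h.totalStructure S).applyφ Y) := (h.totalStructure S).smooth_φ.apply hY
  have hπφ : ∀ v : TangentSpace I' p, mfderiv I' I π p ((h.totalStructure S).φ p v)
      = S.φ (π p) (mfderiv I' I π p v) + β p v • S.ξ (π p) := h.proj_liftEnd p
  have hαφ : ∀ v : TangentSpace I' p, α p ((h.totalStructure S).φ p v) = 0 := h.α_liftEnd p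
  have hβφ : ∀ v : TangentSpace I' p, β p ((h.totalStructure S).φ p v)
      = -S.η (π p) (mfderiv I' I π p v) := h.β_liftEnd p
  have hπ₁ : ∀ Z : VField I' P, coord I (π p) (π p) (mfderiv I' I π p (Z p))
      = pushCoord I π p Z p := fun _ => rfl
  have hπ₂ : ∀ Z : VField I' P, pushCoord I π p ((h.totalStructure S).applyφ Z) p
      = endCoord S.φ (π p) (π p) (pushCoord I π p Z p)
        + β p (Z p) • fieldCoord S.ξ (π p) (π p) := fun Z => by
    rw [pushCoord, AlmostContactMetric.applyφ, hπφ, map_add, map_smul, ← endCoord_coord hmem]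
    rfl
  have hB := fun {V W : VField I' P} (hV : SmoothField V) (hW : SmoothField W) =>
    (show coord I (π p) (π p) (mfderiv I' I π p (VectorField.mlieBracket I' V W p)) = _ from
      pushCoord_mlieBracket h.smooth_proj p hV hW)
  have hT : (h.totalStructure S).ξ p = ζ p := rfl
  have hdη : dOne (h.totalStructure S).η X Y p
      = κ₁ (π p) (mfderiv I' I π p (X p)) (mfderiv I' I π p (Y p)) := by
    rw [← hα X Y hX hY p]
    congr 1
    exact funext fun q => h.totalStructure_η S q
  -- The tensor is tested separately under `π_*`, `α` and `β`.
  refine h.ext ?_ ?_ ?_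
  · have hinj : ∀ v : TangentSpace I (π p), coord I (π p) (π p) v = 0 → v = 0 := fun v hv => by
      rw [← coordSymm_coord hmem v, hv, map_zero]
    rw [map_zero]
    apply hinj
    have key := J.horizontal_eq_zero (pushCoord I π p X p) (pushCoord I π p Y p)
      (mvfderiv I' (pushCoord I π p Y) p ((h.totalStructure S).applyφ X p))
      (mvfderiv I' (pushCoord I π p X) p ((h.totalStructure S).applyφ Y p))
      (mvfderiv I' (pushCoord I π p Y) p (X p)) (mvfderiv I' (pushCoord I π p X) p (Y p))
      (β p (X p)) (β p (Y p))
      (mvfderiv I' (fun q => β q (Y q)) p ((h.totalStructure S).applyφ X p))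
      (mvfderiv I' (fun q => β q (X q)) p ((h.totalStructure S).applyφ Y p))
      (mvfderiv I' (fun q => β q (Y q)) p (X p)) (mvfderiv I' (fun q => β q (X q)) p (Y p))
      (β p (VectorField.mlieBracket I' ((h.totalStructure S).applyφ X) Y p))
      (β p (VectorField.mlieBracket I' X ((h.totalStructure S).applyφ Y) p)) ?_
    · simp only [AlmostContactMetric.sasakiHatakeyama, map_add, map_sub, map_smul, hT, h.proj_ζ,
        (h.totalStructure S).φ_φ, map_neg, hπφ, smul_zero, add_zero, ← endCoord_coord hmem,
        hB hφX hφY, hB hX hY, hB hφX hY, hB hX hφY, h.mvfderiv_pushCoord_applyφ S hX,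
        h.mvfderiv_pushCoord_applyφ S hY, hπ₁, hπ₂]
      rw [← key]
      simp only [map_add, map_sub, map_smul, add_apply, smul_apply, fieldCoord]
      module
    -- The `β`-parts of `[φ̂X, Y]` and `[X, φ̂Y]` matter here only through their sum, in which the
    -- two `κ₂` terms cancel by skewness of `φ` for `κ₂`.
    · rw [hβ.apply_mlieBracket hφX hY, hβ.apply_mlieBracket hX hφY, h.mvfderiv_β_applyφ S hX,
        h.mvfderiv_β_applyφ S hY, hπ₁, hπ₁]
      simp only [AlmostContactMetric.applyφ, hπφ, map_add, map_smul, add_apply, smul_apply,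
        h₂.ξ_left, h₂.ξ_right, h₂.φ_left, smul_zero, add_zero]
      ring
  -- As `α ∘ φ̂ = 0`, only `α [φ̂X, φ̂Y] = -κ₁(φ·, φ·)` and `dη̂(X, Y) = κ₁` survive.
  · simp only [AlmostContactMetric.sasakiHatakeyama, map_add, map_sub, map_smul, hαφ, hdη, hT,
      h.α_ζ, hα.apply_mlieBracket hφX hφY, h.mvfderiv_α_applyφ, map_zero]
    simp only [AlmostContactMetric.applyφ, hπφ, map_add, map_smul, add_apply, smul_apply,
      h₁.ξ_left, h₁.ξ_right, h₁ _ _ _, add_zero, smul_eq_mul]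
    ring
  · have key := J.vertical_eq_zero (pushCoord I π p X p) (pushCoord I π p Y p)
      (mvfderiv I' (pushCoord I π p Y) p ((h.totalStructure S).applyφ X p))
      (mvfderiv I' (pushCoord I π p X) p ((h.totalStructure S).applyφ Y p))
      (mvfderiv I' (pushCoord I π p Y) p (X p)) (mvfderiv I' (pushCoord I π p X) p (Y p))
      (β p (X p)) (β p (Y p))
      (mvfderiv I' (fun q => β q (Y q)) p (X p)) (mvfderiv I' (fun q => β q (X q)) p (Y p))
    simp only [AlmostContactMetric.sasakiHatakeyama, map_add, map_sub, map_smul, hT, h.β_ζ,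
      (h.totalStructure S).φ_φ, map_neg, hβφ, smul_zero, add_zero,
      hβ.apply_mlieBracket hφX hφY, hβ.apply_mlieBracket hX hY, ← formCoord_coord hmem,
      hB hφX hY, hB hX hφY, h.mvfderiv_pushCoord_applyφ S hX,
      h.mvfderiv_pushCoord_applyφ S hY, h.mvfderiv_β_applyφ S hX, h.mvfderiv_β_applyφ S hY,
      hπ₁, hπ₂, map_zero]
    simp only [AlmostContactMetric.applyφ, hπφ, map_add, map_smul, add_apply, smul_apply,
      h₂.ξ_left, h₂.ξ_right, h₂ _ _ _, smul_eq_mul]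
    simp only [AlmostContactMetric.applyφ, map_add, map_sub, map_smul, add_apply, smul_apply,
      smul_eq_mul] at key
    linear_combination key

end IsVerticalFrame
end Normality
end TorusBundleST

namespace TorusBundleST

/-! ## The Reeb field is Killing -/

section Killing

variable {E : Type*} [NormedAddCommGroup E] [NormedSpace ℝ E]
  {H : Type*} [TopologicalSpace H] {I : ModelWithCorners ℝ E H} [I.Boundaryless]
  {M : Type*} [TopologicalSpace M] [ChartedSpace H M] [IsManifold I ∞ M]
  {E' : Type*} [NormedAddCommGroup E'] [NormedSpace ℝ E']
  {H' : Type*} [TopologicalSpace H'] {I' : ModelWithCorners ℝ E' H'} [I'.Boundaryless]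
  {P : Type*} [TopologicalSpace P] [ChartedSpace H' P] [IsManifold I' ∞ P]
  [FiniteDimensional ℝ E] [FiniteDimensional ℝ E']

namespace IsVerticalFrame

variable {π : P → M} {α β : OneTensor I' P} {ζ χ : VField I' P}
  (h : IsVerticalFrame I π α β ζ χ)

/-- Along a vertical direction, only the vector fields contribute to the derivative of a
pulled-back bilinear form. -/
lemma mvfderiv_pullback_bilin (h : IsVerticalFrame I π α β ζ χ) {g : TwoTensor I M}
    (hg : ∀ x₀, ContMDiffAt I 𝓘(ℝ, E →L[ℝ] E →L[ℝ] ℝ) ∞ (bilinCoord g x₀) x₀)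
    {X Y : VField I' P} (hX : SmoothField X) (hY : SmoothField Y) (p : P) {w : TangentSpace I' p}
    (hw : mfderiv I' I π p w = 0) :
    mvfderiv I' (fun q => g (π q) (mfderiv I' I π q (X q)) (mfderiv I' I π q (Y q))) p w
      = bilinCoord g (π p) (π p) (mvfderiv I' (pushCoord I π p X) p w) (pushCoord I π p Y p)
        + bilinCoord g (π p) (π p) (pushCoord I π p X p)
            (mvfderiv I' (pushCoord I π p Y) p w) := by
  have hg' := (hg (π p)).mdifferentiableAt (by simp)
  have hu := (contMDiffAt_pushCoord h.smooth_proj p hX).mdifferentiableAt (by simp)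
  have hv := (contMDiffAt_pushCoord h.smooth_proj p hY).mdifferentiableAt (by simp)
  have hgπ := h.mdifferentiableAt_comp_proj hg'
  have h0 : (fun q => g (π q) (mfderiv I' I π q (X q)) (mfderiv I' I π q (Y q))) =ᶠ[nhds p]
      fun q => bilinCoord g (π p) (π q) (pushCoord I π p X q) (pushCoord I π p Y q) := by
    filter_upwards [h.eventually_proj_mem p] with q hq
    rw [pushCoord, pushCoord, bilinCoord_coord hq]
  rw [mvfderiv_congr h0, mvfderiv_clm_apply (hgπ.clm_apply hu) hv, mvfderiv_clm_apply hgπ hu,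
    h.mvfderiv_proj hg', hw]
  simp

/-- The Reeb field of the total space is Killing. -/
lemma isKilling_totalStructure (S : AlmostContactMetric I M)
    {κ₁ κ₂ : TwoTensor I M} (hα : HasExteriorDerivative I π α κ₁)
    (hβ : HasExteriorDerivative I π β κ₂) : (h.totalStructure S).IsKilling := by
  have hcomp : CompleteSpace E' := FiniteDimensional.complete ℝ E'
  intro X Y hX hY p
  have hg := smoothTwoTensor_iff_coord.1 S.g.contMDiff
  have hmem := mem_chart_source H (π p)
  -- This is `L_ζ α = 0`: `α(ζ)` is constant and `dα`, being a pull-back, vanishes on the vertical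
  -- `ζ`. The same holds for `β`, and `π_*[ζ, Z]` is the derivative of `π_* Z` along `ζ`.
  have hαζ : ∀ {Z : VField I' P}, SmoothField Z →
      α p (VectorField.mlieBracket I' ζ Z p) = mvfderiv I' (fun q => α q (Z q)) p (ζ p) := by
    intro Z hZ
    rw [hα.apply_mlieBracket h.smooth_ζ hZ, funext h.α_ζ, h.proj_ζ, mvfderiv_const]
    simp
  have hβζ : ∀ {Z : VField I' P}, SmoothField Z →
      β p (VectorField.mlieBracket I' ζ Z p) = mvfderiv I' (fun q => β q (Z q)) p (ζ p) := by
    intro Z hZ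
    rw [hβ.apply_mlieBracket h.smooth_ζ hZ, funext h.β_ζ, h.proj_ζ, mvfderiv_const]
    simp
  have hπζ : ∀ {Z : VField I' P}, SmoothField Z →
      coord I (π p) (π p) (mfderiv I' I π p (VectorField.mlieBracket I' ζ Z p))
        = mvfderiv I' (pushCoord I π p Z) p (ζ p) := by
    intro Z hZ
    have h0 : pushCoord I π p ζ = fun _ => 0 := funext fun q => by
      rw [pushCoord, h.proj_ζ, map_zero]
    have h1 := pushCoord_mlieBracket h.smooth_proj p h.smooth_ζ hZ
    rwa [h0, mvfderiv_const, zero_apply, sub_zero] at h1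
  have hαX := (h.smooth_α.apply hX p).mdifferentiableAt (by simp)
  have hαY := (h.smooth_α.apply hY p).mdifferentiableAt (by simp)
  have hβX := (h.smooth_β.apply hX p).mdifferentiableAt (by simp)
  have hβY := (h.smooth_β.apply hY p).mdifferentiableAt (by simp)
  have hgXY : MDifferentiableAt I' 𝓘(ℝ, ℝ)
      (fun q => S.g.inner (π q) (mfderiv I' I π q (X q)) (mfderiv I' I π q (Y q))) p := by
    refine ((h.mdifferentiableAt_comp_proj ((hg (π p)).mdifferentiableAt (by simp))).clm_apply
      ((contMDiffAt_pushCoord h.smooth_proj p hX).mdifferentiableAt (by simp))).clm_apply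
      ((contMDiffAt_pushCoord h.smooth_proj p hY).mdifferentiableAt (by simp))
      |>.congr_of_eventuallyEq ?_
    filter_upwards [h.eventually_proj_mem p] with q hq
    exact (bilinCoord_coord hq _ _).symm
  rw [show (h.totalStructure S).ξ = ζ from rfl, dirDeriv_eq_mvfderiv]
  simp only [h.totalStructure_inner S]
  have hm : ∀ {f k : P → ℝ}, MDifferentiableAt I' 𝓘(ℝ, ℝ) f p → MDifferentiableAt I' 𝓘(ℝ, ℝ) k p →
      mvfderiv I' (fun q => f q * k q) p (ζ p)
        = mvfderiv I' f p (ζ p) * k p + f p * mvfderiv I' k p (ζ p) := by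
    intro f k hf hk
    have := congrArg (fun L => L (ζ p)) (mvfderiv_fun_smul hf hk)
    simp only [smul_eq_mul] at this
    rw [this]
    simp
    ring
  have hd : ∀ {f k : P → ℝ}, MDifferentiableAt I' 𝓘(ℝ, ℝ) f p → MDifferentiableAt I' 𝓘(ℝ, ℝ) k p →
      MDifferentiableAt I' 𝓘(ℝ, ℝ) (fun q => f q * k q) p := fun hf hk => hf.mul hk
  have hs : MDifferentiableAt I' 𝓘(ℝ, ℝ)
      (fun q => α q (X q) * α q (Y q) + β q (X q) * β q (Y q)) p :=
    (hd hαX hαY).add (hd hβX hβY)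
  rw [mvfderiv_fun_add hs hgXY, mvfderiv_fun_add (hd hαX hαY) (hd hβX hβY), add_apply, add_apply,
    h.mvfderiv_pullback_bilin hg hX hY p (h.proj_ζ p)]
  simp only [← bilinCoord_coord hmem, hπζ hX, hπζ hY, hαζ hX, hαζ hY, hβζ hX, hβζ hY]
  rw [hm hαX hαY, hm hβX hβY]
  simp only [pushCoord]
  ring

end IsVerticalFrame
end Killing
end TorusBundleST

namespace TorusBundleST

/-! ## Principal torus bundles -/

section TorusBundle

variable {E : Type*} [NormedAddCommGroup E] [NormedSpace ℝ E]
  {H : Type*} [TopologicalSpace H] {I : ModelWithCorners ℝ E H} [I.Boundaryless]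
  {M : Type*} [TopologicalSpace M] [ChartedSpace H M] [IsManifold I ∞ M]
  {E' : Type*} [NormedAddCommGroup E'] [NormedSpace ℝ E']
  {H' : Type*} [TopologicalSpace H'] {I' : ModelWithCorners ℝ E' H'} [I'.Boundaryless]
  {P : Type*} [TopologicalSpace P] [ChartedSpace H' P] [IsManifold I' ∞ P]
  [MulAction Torus P] {π : P → M} {ω₁ ω₂ : OneTensor I' P}

/-- The projection of a principal torus bundle is a submersion. -/
lemma IsPrincipalTorusBundle.surjective_mfderiv (hπ : IsPrincipalTorusBundle I I' π) (p : P) :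
    Function.Surjective (mfderiv I' I π p) := by
  obtain ⟨e, he, -, hsymm, -⟩ := hπ.locally_trivial (π p)
  have hp : p ∈ e.source := e.mem_source.2 he
  -- A local section through `p`, with constant fibre coordinate; its differential is a right
  -- inverse of that of `π`.
  let s : M → P := fun y => e.toOpenPartialHomeomorph.symm (y, (e p).2)
  have hsp : s (π p) = p := e.symm_apply_mk_proj hp
  have hs : MDifferentiableAt I I' s (π p) := by
    have h1 : ContMDiffAt (I.prod torusModel) I' ∞ e.toOpenPartialHomeomorph.symm
        (π p, (e p).2) :=
      hsymm.contMDiffAt (e.open_target.mem_nhds (e.mem_target.2 he))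
    exact (h1.comp (π p) (contMDiffAt_id.prodMk contMDiffAt_const)).mdifferentiableAt (by simp)
  have hid : π ∘ s =ᶠ[nhds (π p)] id := by
    filter_upwards [e.open_baseSet.mem_nhds he] with y hy using e.proj_symm_apply' hy
  have h1 := mfderiv_comp (π p) (hπ.smooth_proj.mdifferentiable (by simp) (s (π p))) hs
  rw [hid.mfderiv_eq, mfderiv_id] at h1
  have h2 : ∀ (x y : P) (u : E'), x = y →
      (mfderiv I' I π x : E' →L[ℝ] E) u = (mfderiv I' I π y : E' →L[ℝ] E) u := by
    rintro x _ u rfl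
    rfl
  intro u
  refine ⟨(mfderiv I I' s (π p) : E →L[ℝ] E') u, ?_⟩
  have h3 := congrArg (fun L : E →L[ℝ] E => L u) h1
  exact ((h2 _ _ _ hsp).symm.trans h3.symm :)

/-- A rotation of a connection form and of the fundamental vector fields. -/
lemma IsConnection.isVerticalFrame (hω : IsConnection ω₁ ω₂) (hπ : IsPrincipalTorusBundle I I' π)
    (hdim : Module.finrank ℝ E' = Module.finrank ℝ E + 2) {s t : ℝ} (hst : s ^ 2 + t ^ 2 = 1) :
    IsVerticalFrame I π (fun p => t • ω₁ p + s • ω₂ p) (fun p => (-s) • ω₁ p + t • ω₂ p)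
      (fun p => t • fundX₁ I' p + s • fundX₂ I' p)
      (fun p => (-s) • fundX₁ I' p + t • fundX₂ I' p) where
  smooth_proj := hπ.smooth_proj
  surjective := hπ.surjective_mfderiv
  finrank_eq := hdim
  smooth_α := (hω.smooth₁.const_smul t).add (hω.smooth₂.const_smul s)
  smooth_β := (hω.smooth₁.const_smul (-s)).add (hω.smooth₂.const_smul t)
  smooth_ζ := ((smoothField_fundamentalField hπ 1 0).const_smul t).add
    ((smoothField_fundamentalField hπ 0 1).const_smul s)
  α_ζ p := by
    simp only [add_apply, smul_apply, map_add, map_smul, smul_eq_mul, hω.fund₁₁, hω.fund₁₂,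
      hω.fund₂₁, hω.fund₂₂]
    linarith
  α_χ p := by
    simp only [add_apply, smul_apply, map_add, map_smul, smul_eq_mul, hω.fund₁₁, hω.fund₁₂,
      hω.fund₂₁, hω.fund₂₂]
    ring
  β_ζ p := by
    simp only [add_apply, smul_apply, map_add, map_smul, smul_eq_mul, hω.fund₁₁, hω.fund₁₂,
      hω.fund₂₁, hω.fund₂₂]
    ring
  β_χ p := by
    simp only [add_apply, smul_apply, map_add, map_smul, smul_eq_mul, hω.fund₁₁, hω.fund₁₂,
      hω.fund₂₁, hω.fund₂₂]
    linarith
  proj_ζ p := by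
    rw [map_add, map_smul, map_smul, fundX₁, fundX₂, mfderiv_fundamentalField hπ,
      mfderiv_fundamentalField hπ, smul_zero, smul_zero, add_zero]
  proj_χ p := by
    rw [map_add, map_smul, map_smul, fundX₁, fundX₂, mfderiv_fundamentalField hπ,
      mfderiv_fundamentalField hπ, smul_zero, smul_zero, add_zero]

/-- Subtracting the vertical part `ω₁(w) X₁ + ω₂(w) X₂` from any preimage `w` gives a horizontal
one, so the default value `0` does not occur. -/
lemma IsConnection.horizontalLift_spec (hω : IsConnection ω₁ ω₂)
    (hπ : IsPrincipalTorusBundle I I' π) (p : P) (u : TangentSpace I (π p)) :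
    mfderiv I' I π p (horizontalLift π ω₁ ω₂ p u) = u ∧ ω₁ p (horizontalLift π ω₁ ω₂ p u) = 0
      ∧ ω₂ p (horizontalLift π ω₁ ω₂ p u) = 0 := by
  have hex : ∃ w : TangentSpace I' p, mfderiv I' I π p w = u ∧ ω₁ p w = 0 ∧ ω₂ p w = 0 := by
    obtain ⟨w, hw⟩ := hπ.surjective_mfderiv p u
    refine ⟨w - ω₁ p w • fundX₁ I' p - ω₂ p w • fundX₂ I' p, ?_, ?_, ?_⟩
    · rw [map_sub, map_sub, map_smul, map_smul, fundX₁, fundX₂, mfderiv_fundamentalField hπ,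
        mfderiv_fundamentalField hπ, smul_zero, smul_zero, sub_zero, sub_zero, hw]
    · simp [hω.fund₁₁, hω.fund₁₂]
    · simp [hω.fund₂₁, hω.fund₂₂]
  rw [horizontalLift, dif_pos hex]
  exact hex.choose_spec

lemma HasCurvature.linearCombination {σ₁ σ₂ : TwoTensor I M} (h₁ : HasCurvature π ω₁ σ₁)
    (h₂ : HasCurvature π ω₂ σ₂) (hω : IsConnection ω₁ ω₂) (a b : ℝ) :
    HasExteriorDerivative I π (fun p => a • ω₁ p + b • ω₂ p)
      (fun x => (2 * Real.pi * a) • σ₁ x + (2 * Real.pi * b) • σ₂ x) := by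
  intro X Y hX hY p
  rw [dOne_linearCombination hω.smooth₁ hω.smooth₂ a b hX hY]
  simp only [add_apply, smul_apply, smul_eq_mul]
  rw [← h₁ X Y hX hY p, ← h₂ X Y hX hY p]
  field_simp

end TorusBundle
end TorusBundleST

/-! ### The main theorem -/

open TorusBundleST in
theorem mainTheorem10 {n : ℕ}
    {M : Type*} [TopologicalSpace M] [T2Space M] [SecondCountableTopology M]
    [ChartedSpace (EuclideanSpace ℝ (Fin n)) M] [IsManifold (𝓡 n) ∞ M]
    (S : AlmostContactMetric (𝓡 n) M) (hS : S.IsNormal)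
    (σ₁ σ₂ : TwoTensor (𝓡 n) M)
    (hσ₁ : SmoothTwoForm σ₁) (hσ₂ : SmoothTwoForm σ₂)
    (hclosed₁ : ClosedTwoForm σ₁) (hclosed₂ : ClosedTwoForm σ₂)
    (hinv₁ : S.Invariant σ₁) (hinv₂ : S.Invariant σ₂)
    {P : Type*} [TopologicalSpace P] [T2Space P] [SecondCountableTopology P]
    [ChartedSpace (EuclideanSpace ℝ (Fin (n + 2))) P] [IsManifold (𝓡 (n + 2)) ∞ P]
    [MulAction Torus P] (π : P → M)
    (hπ : IsPrincipalTorusBundle (𝓡 n) (𝓡 (n + 2)) π)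
    (hchern : HasChernClasses (I' := 𝓡 (n + 2)) π σ₁ σ₂) :
    (∃ ω₁ ω₂ : OneTensor (𝓡 (n + 2)) P,
      IsConnection ω₁ ω₂ ∧ HasCurvature π ω₁ σ₁ ∧ HasCurvature π ω₂ σ₂) ∧
    ∀ ω₁ ω₂ : OneTensor (𝓡 (n + 2)) P,
      IsConnection ω₁ ω₂ → HasCurvature π ω₁ σ₁ → HasCurvature π ω₂ σ₂ →
      ∀ s t : ℝ, s ^ 2 + t ^ 2 = 1 →
        ∃ T : AlmostContactMetric (𝓡 (n + 2)) P, T.IsST ∧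
          (∀ (p : P) (v w : TangentSpace (𝓡 (n + 2)) p),
            T.g.inner p v w = ω₁ p v * ω₁ p w + ω₂ p v * ω₂ p w
              + S.g.inner (π p) (mfderiv (𝓡 (n + 2)) (𝓡 n) π p v)
                  (mfderiv (𝓡 (n + 2)) (𝓡 n) π p w)) ∧
          (∀ p : P, T.ξ p = t • fundX₁ (𝓡 (n + 2)) p + s • fundX₂ (𝓡 (n + 2)) p) ∧
          (∀ p : P, T.η p = t • ω₁ p + s • ω₂ p) ∧
          (∀ (p : P) (v : TangentSpace (𝓡 (n + 2)) p),
            T.φ p v =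
              horizontalLift (I := 𝓡 n) π ω₁ ω₂ p
                  (S.φ (π p) (mfderiv (𝓡 (n + 2)) (𝓡 n) π p v))
                + (-s * ω₁ p v + t * ω₂ p v) • horizontalLift (I := 𝓡 n) π ω₁ ω₂ p (S.ξ (π p))
                - S.η (π p) (mfderiv (𝓡 (n + 2)) (𝓡 n) π p v)
                  • (-s • fundX₁ (𝓡 (n + 2)) p + t • fundX₂ (𝓡 (n + 2)) p)) := by

  refine ⟨hchern.exists_connection hπ, fun ω₁ ω₂ hω hc₁ hc₂ s t hst => ?_⟩
  have h := hω.isVerticalFrame hπ (by simp) hst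
  have hα := hc₁.linearCombination hc₂ hω t s
  have hβ := hc₁.linearCombination hc₂ hω (-s) t
  refine ⟨h.totalStructure S, ⟨h.isNormal_totalStructure hS hα hβ
    (hinv₁.linearCombination hinv₂ _ _) (hinv₁.linearCombination hinv₂ _ _),
    h.isKilling_totalStructure S hα hβ⟩, fun p v w => ?_, fun p => rfl, h.totalStructure_η S,
    fun p v => ?_⟩
  · rw [h.totalStructure_inner S]
    simp only [add_apply, smul_apply, smul_eq_mul]
    -- A rotation of `(ω₁, ω₂)` preserves the sum of squares.
    linear_combination (ω₁ p v * ω₁ p w + ω₂ p v * ω₂ p w) * hst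
  · obtain ⟨hu, hu₁, hu₂⟩ := hω.horizontalLift_spec hπ p
      (S.φ (π p) (mfderiv (𝓡 (n + 2)) (𝓡 n) π p v))
    obtain ⟨hξ, hξ₁, hξ₂⟩ := hω.horizontalLift_spec hπ p (S.ξ (π p))
    have hX : mfderiv (𝓡 (n + 2)) (𝓡 n) π p
        ((-s) • fundX₁ (𝓡 (n + 2)) p + t • fundX₂ (𝓡 (n + 2)) p) = 0 := h.proj_χ p
    rw [h.totalStructure_φ S]
    -- The lift was defined through the splitting; it agrees with the formula by horizontal lifts
    -- because `π_*`, `η̂` and `η̂^⊥` determine a tangent vector.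
    refine h.ext ?_ ?_ ?_
    · rw [h.proj_liftEnd, map_sub, map_add, map_smul, map_smul, hu, hξ, hX, smul_zero, sub_zero]
      rfl
    · rw [h.α_liftEnd]
      simp only [add_apply, smul_apply, smul_eq_mul, map_sub, map_add, map_smul, hu₁, hu₂, hξ₁, hξ₂,
        hω.fund₁₁, hω.fund₁₂, hω.fund₂₁, hω.fund₂₂]
      ring
    · rw [h.β_liftEnd]
      simp only [add_apply, smul_apply, smul_eq_mul, map_sub, map_add, map_smul, hu₁, hu₂, hξ₁, hξ₂,
        hω.fund₁₁, hω.fund₁₂, hω.fund₂₁, hω.fund₂₂]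
      linear_combination S.η (π p) (mfderiv (𝓡 (n + 2)) (𝓡 n) π p v) * hst
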